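/- Model. Let $p$ be a prime, $\mathbb{G}_1,\mathbb{G}_2$ cyclic groups of order $p$, and $e\colon\mathbb{G}_1\times\mathbb{G}_1\to\mathbb{G}_2$ a cryptographic pairing: $e(x^a,y^b)=e(x,y)^{ab}$ for all $x,y\in\mathbb{G}_1$ and $a,b\in\mathbb{Z}$, and $e(g,g)$ generates $\mathbb{G}_2$ whenever $g$ generates $\mathbb{G}_1$. Group elements and scalars are represented by bit strings. An algorithm is a probabilistic straight-line program that uses bit operations (including multiplexing, coin flips, and reading and writing the bits of representations of group elements and of scalars in $\mathbb{Z}_p$), each of which takes one step ($n+1$ steps for assembling an element or a scalar from $n$ bits), and the basic operations: multiplication, inversion and exponentiation in $\mathbb{G}_1$ and $\mathbb{G}_2$, the pairing, arithmetic in $\mathbb{Z}_p$, equality tests, and uniform sampling from $\mathbb{G}_1,\mathbb{G}_2,\mathbb{Z}_p,\mathbb{Z}_p^*$. Each basic operation takes a given time, and $\tau-1$ denotes the sum of these times over all the basic operations. The running time of a program is the total cost of its instructions; that of an interactive machine is the total over all its moves. The pairing $e$ is $(t',\epsilon')$-one-way if every algorithm $\mathcal{C}$ running in time at most $t'$ satisfies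 $\Pr[e(g,\mathcal{C}(g,x))=x]<\epsilon'$, over uniform $g\in\mathbb{G}_1$, $x\in\mathbb{G}_2$ and the coins of $\mathcal{C}$. An attack $(\mathcal{A},\mathcal{B})$ on a scheme $(\mathcal{G},\mathcal{P},\mathcal{V})$ proceeds as follows. $\mathcal{G}$ generates a key pair; $\mathcal{B}$, given the public key, interacts as a verifier $q$ times, one after the other, with the honest prover $\mathcal{P}$ and outputs some $T$; then $\mathcal{A}$, given the public key and $T$, interacts as a prover with the honest verifier $\mathcal{V}$. It succeeds if $\mathcal{V}$ accepts; its running time is the sum of those of $\mathcal{A}$ and $\mathcal{B}$. The scheme is $(t,q,\epsilon)$-secure if, for every input $\alpha\in\{0,1\}^*$ of $\mathcal{G}$, every attack of running time at most $t$ succeeds with probability less than $\epsilon$ (over key generation and all coins). It is a $(t,q,\epsilon)$-identification scheme if moreover $\mathcal{G}$ runs in polynomial time, $\mathcal{P}$ and $\mathcal{V}$ run in time at most $t$, and for every $\alpha$ the honest prover is accepted with probability $1$. Protocol. Key generation (ignoring $\alpha$): pick uniform $P,Q\in\mathbb{G}_1$, $y\in\mathbb{G}_2$, $s\in\mathbb{Z}_p^*$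 and put $v=e(P,Q)^{-1}y^{-s}$; the public key is $(P,y,v)$ and the secret key is $(Q,s)$. Identification: (1) the prover picks uniform $R\in\mathbb{G}_1$, $r\in\mathbb{Z}_p$ and sends $x=e(P,R)\,y^r$; (2) the verifier sends a uniform $m\in\mathbb{Z}_p^*$; (3) the prover sends $T=R\,Q^m$ and $a=r+ms$; (4) the verifier accepts if and only if $e(P,T)\,y^a\,v^m=x$. Theorem. There is an absolute constant $K$ such that for all $p,\mathbb{G}_1,\mathbb{G}_2$, all cryptographic pairings $e$, all representations and all operation times, there are natural numbers $c_0,c_s,c_h\le K\tau$ with the following properties. 1. If $e$ is a $(t',\epsilon')$-one-way pairing, and $$\epsilon\ge\max\Bigl\{3\sqrt{\epsilon'},\frac2p\Bigr\}\quad\text{and}\quad t\le\frac{t'}2-c_0-c_s q,$$ then the protocol is $(t,q,\epsilon)$-secure, and if in addition $t\ge c_h$, it is a $(t,q,\epsilon)$-identification scheme. There is no further condition on $\epsilon'$ or on $p$. 2. For every $q$ and every attack of running time $t$ and success probability $\epsilon$ there is an algorithm of running time at most $2(t+c_sq)+2c_0$ that inverts the pairing with probability at least $\epsilon^2/9$.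 -/

import Mathlib

noncomputable section

namespace PairingId

/-! ### The machine model

An algorithm is a probabilistic straight-line program over registers that hold bits, elements of
`G₁` and `G₂` and scalars of `ℤ/p`.  Every instruction appends one new register.  Programs are not
restricted to generic group operations: group elements and scalars are represented by bit strings,
which a program can read and write bit by bit, and data-dependent branching is available through
the multiplexer `sel`.  There are no jumps, so the running time (the total cost of the instructions
executed) also pays for the length of the description, and a table of precomputed answers is never
free of charge. -/

/-- The operations whose duration depends on the groups and on the pairing. -/
inductive Op where
  | mul1 | inv1 | pow1 | mul2 | inv2 | pow2 | pair
  | addZ | negZ | mulZ | invZ | eq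
  | sample1 | sample2 | sampleZ | sampleU

/-- Instructions; the arguments `i j c` and the entries of `l` are register numbers.  Operations
with fewer than two arguments ignore the superfluous ones. -/
inductive Instr where
  | const (b : Bool)
  | nand (i j : ℕ)
  | coin
  | sel (c i j : ℕ)
  | getBit (k i : ℕ)
  | pack1 (l : List ℕ)
  | pack2 (l : List ℕ)
  | packZ (l : List ℕ)
  | op (o : Op) (i j : ℕ)

/-- Contents of a register. -/
inductive Val (p : ℕ) (G₁ G₂ : Type*) where
  | bit (b : Bool)
  | el1 (g : G₁)
  | el2 (x : G₂)
  | sc (a : ZMod p)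

/-- A map `e : G₁ × G₁ → G₂` together with what makes it an object of computation: the
representation of group elements by natural numbers (bit strings) and the time that each of the
basic operations takes. -/
structure PairingData (p : ℕ) (G₁ G₂ : Type*) where
  e : G₁ → G₁ → G₂
  repr₁ : G₁ ↪ ℕ
  repr₂ : G₂ ↪ ℕ
  cost : Op → ℕ

/-- `e` is a cryptographic pairing between groups of order `p`. -/
structure PairingData.IsCryptographicPairing {p : ℕ} {G₁ G₂ : Type*} [Group G₁] [Group G₂]
    (D : PairingData p G₁ G₂) : Prop where
  card_left : Nat.card G₁ = p
  card_right : Nat.card G₂ = p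
  bilinear : ∀ (x y : G₁) (a b : ℤ), D.e (x ^ a) (y ^ b) = D.e x y ^ (a * b)
  nondegenerate : ∀ g : G₁, (∀ x, x ∈ Subgroup.zpowers g) →
    ∀ z, z ∈ Subgroup.zpowers (D.e g g)

/-- The time for performing each basic operation once. -/
def PairingData.opTime {p : ℕ} {G₁ G₂ : Type*} (D : PairingData p G₁ G₂) : ℕ :=
  1 + (([.mul1, .inv1, .pow1, .mul2, .inv2, .pow2, .pair, .addZ, .negZ, .mulZ, .invZ, .eq,
    .sample1, .sample2, .sampleZ, .sampleU] : List Op).map D.cost).sum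

section Values

variable {p : ℕ} {G₁ G₂ : Type*}

def Val.toBit : Val p G₁ G₂ → Bool
  | .bit b => b
  | _ => false

def Val.toG1 [One G₁] : Val p G₁ G₂ → G₁
  | .el1 g => g
  | _ => 1

def Val.toG2 [One G₂] : Val p G₁ G₂ → G₂
  | .el2 x => x
  | _ => 1

def Val.toZ : Val p G₁ G₂ → ZMod p
  | .sc a => a
  | _ => 0

/-- The number whose binary digits represent the value. -/
def Val.code (D : PairingData p G₁ G₂) : Val p G₁ G₂ → ℕ
  | .bit b => b.toNat
  | .el1 g => D.repr₁ g
  | .el2 x => D.repr₂ x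
  | .sc a => a.val

/-- Content of register `i`; a register that does not exist reads as the bit `0`. -/
def reg (σ : List (Val p G₁ G₂)) (i : ℕ) : Val p G₁ G₂ := σ.getD i (.bit false)

/-- The number with the binary digits in the registers `l`, least significant digit first. -/
def readNat (σ : List (Val p G₁ G₂)) (l : List ℕ) : ℕ :=
  Nat.ofDigits 2 (l.map fun i => (reg σ i).toBit.toNat)

end Values

section Execution

variable {p : ℕ} [Fact p.Prime] {G₁ G₂ : Type*} [CommGroup G₁] [Fintype G₁] [CommGroup G₂]
  [Fintype G₂]

open Classical in
/-- The (random) value computed by a basic operation with arguments `u` and `w`. -/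
def Op.eval (D : PairingData p G₁ G₂) (u w : Val p G₁ G₂) : Op → PMF (Val p G₁ G₂)
  | .mul1 => PMF.pure (.el1 (u.toG1 * w.toG1))
  | .inv1 => PMF.pure (.el1 u.toG1⁻¹)
  | .pow1 => PMF.pure (.el1 (u.toG1 ^ w.toZ.val))
  | .mul2 => PMF.pure (.el2 (u.toG2 * w.toG2))
  | .inv2 => PMF.pure (.el2 u.toG2⁻¹)
  | .pow2 => PMF.pure (.el2 (u.toG2 ^ w.toZ.val))
  | .pair => PMF.pure (.el2 (D.e u.toG1 w.toG1))
  | .addZ => PMF.pure (.sc (u.toZ + w.toZ))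
  | .negZ => PMF.pure (.sc (-u.toZ))
  | .mulZ => PMF.pure (.sc (u.toZ * w.toZ))
  | .invZ => PMF.pure (.sc u.toZ⁻¹)
  | .eq => PMF.pure (.bit (decide (u = w)))
  | .sample1 => (PMF.uniformOfFintype G₁).map .el1
  | .sample2 => (PMF.uniformOfFintype G₂).map .el2
  | .sampleZ => (PMF.uniformOfFintype (ZMod p)).map .sc
  | .sampleU => (PMF.uniformOfFintype (ZMod p)ˣ).map fun m => .sc (m : ZMod p)

/-- The (random) value that an instruction writes to the new register.  A bit string that
represents no group element is packed to the neutral element. -/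
def Instr.eval (D : PairingData p G₁ G₂) (σ : List (Val p G₁ G₂)) : Instr → PMF (Val p G₁ G₂)
  | .const b => PMF.pure (.bit b)
  | .nand i j => PMF.pure (.bit !((reg σ i).toBit && (reg σ j).toBit))
  | .coin => (PMF.uniformOfFintype Bool).map .bit
  | .sel c i j => PMF.pure (if (reg σ c).toBit then reg σ i else reg σ j)
  | .getBit k i => PMF.pure (.bit (((reg σ i).code D).testBit k))
  | .pack1 l => PMF.pure (.el1 ((Function.partialInv D.repr₁ (readNat σ l)).getD 1))
  | .pack2 l => PMF.pure (.el2 ((Function.partialInv D.repr₂ (readNat σ l)).getD 1))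
  | .packZ l => PMF.pure (.sc (readNat σ l : ZMod p))
  | .op o i j => o.eval D (reg σ i) (reg σ j)

/-- Run a program on the given registers. -/
def runCode (D : PairingData p G₁ G₂) : List Instr → List (Val p G₁ G₂) →
    PMF (List (Val p G₁ G₂))
  | [], σ => PMF.pure σ
  | i :: c, σ => (i.eval D σ).bind fun v => runCode D c (σ ++ [v])

end Execution

/-- The duration of an instruction: bit operations take one step (one step per bit when a bit
string is assembled), the other operations take the time specified by `cost`. -/
def Instr.time (cost : Op → ℕ) : Instr → ℕ
  | .pack1 l | .pack2 l | .packZ l => l.length + 1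
  | .op o _ _ => cost o
  | _ => 1

def codeTime (cost : Op → ℕ) (c : List Instr) : ℕ := (c.map (Instr.time cost)).sum

/-! ### Interactive machines -/

/-- One move of an interactive machine: store the first `recv` values of the incoming message in
new registers, compute, and send the contents of the registers `send`. -/
structure Phase where
  recv : ℕ
  code : List Instr
  send : List ℕ

/-- The move of a machine that has stopped. -/
def Phase.idle : Phase := ⟨0, [], []⟩

/-- An interactive machine is the list of its moves; the registers persist between moves. -/
abbrev Machine := List Phase

/-- Running time: the total over all moves. -/
def Machine.time (cost : Op → ℕ) (M : Machine) : ℕ :=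
  (M.map fun φ => codeTime cost φ.code).sum

section Interaction

variable {p : ℕ} [Fact p.Prime] {G₁ G₂ : Type*} [CommGroup G₁] [Fintype G₁] [CommGroup G₂]
  [Fintype G₂]

/-- Perform one move; returns the new registers and the message sent. -/
def Phase.run (D : PairingData p G₁ G₂) (φ : Phase) (msg σ : List (Val p G₁ G₂)) :
    PMF (List (Val p G₁ G₂) × List (Val p G₁ G₂)) :=
  (runCode D φ.code (σ ++ (List.range φ.recv).map (reg msg))).map
    fun τ => (τ, φ.send.map (reg τ))

/-- `n` rounds of interaction between `M`, which moves first, and `N`; `msg` is the message that `M`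
receives at its first move.  Returns the registers of `M`, the registers of `N`, and the last
message sent by `N`. -/
def interact (D : PairingData p G₁ G₂) : ℕ → Machine → Machine →
    (msg σ τ : List (Val p G₁ G₂)) →
    PMF (List (Val p G₁ G₂) × List (Val p G₁ G₂) × List (Val p G₁ G₂))
  | 0, _, _, msg, σ, τ => PMF.pure (σ, τ, msg)
  | n + 1, M, N, msg, σ, τ =>
    ((M.headD .idle).run D msg σ).bind fun a =>
      ((N.headD .idle).run D a.2 τ).bind fun b =>
        interact D n M.tail N.tail b.2 a.1 b.1

/-- The output of the machine `B`, with registers `τ`, after `q` consecutive complete interactions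
with the prover `P`; in each of them `P` starts afresh from the registers `σ` with new coins.  After
the last interaction `B` makes one more move, whose message is its output. -/
def outputAfter (D : PairingData p G₁ G₂) (P : Machine) (σ : List (Val p G₁ G₂)) :
    ℕ → Machine → List (Val p G₁ G₂) → PMF (List (Val p G₁ G₂))
  | 0, B, τ => ((B.headD .idle).run D [] τ).map Prod.snd
  | q + 1, B, τ => (interact D P.length P B [] σ τ).bind fun r =>
      outputAfter D P σ q (B.drop P.length) r.2.1

/-- The verdict of the verifier `V` (the first entry of its last message) after interacting
with `M`. -/
def verdict (D : PairingData p G₁ G₂) (M V : Machine) (σ τ : List (Val p G₁ G₂)) : PMF Bool :=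
  (interact D V.length M V [] σ τ).map fun r => (reg r.2.2 0).toBit

end Interaction

/-! ### Identification schemes -/

/-- A key-generation program and the registers in which it leaves the two keys. -/
structure KeyGen where
  code : List Instr
  secretKey : List ℕ
  publicKey : List ℕ

/-- A triple `(G, P, V)`.  `gen α` is the program that `G` executes on the input `α`. -/
structure IdScheme where
  gen : List Bool → KeyGen
  prover : Machine
  verifier : Machine

section Schemes

variable {p : ℕ} [Fact p.Prime] {G₁ G₂ : Type*} [CommGroup G₁] [Fintype G₁] [CommGroup G₂]
  [Fintype G₂]

/-- The random key pair (secret key, public key). -/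
def KeyGen.keys (D : PairingData p G₁ G₂) (g : KeyGen) :
    PMF (List (Val p G₁ G₂) × List (Val p G₁ G₂)) :=
  (runCode D g.code []).map fun σ => (g.secretKey.map (reg σ), g.publicKey.map (reg σ))

/-- The probability that the honest prover is accepted, over key generation and all coins. -/
def IdScheme.honestProb (D : PairingData p G₁ G₂) (S : IdScheme) (α : List Bool) : ℝ :=
  (((S.gen α).keys D).bind (fun k => verdict D S.prover S.verifier (k.1 ++ k.2) k.2) true).toReal

/-- The probability that the attack `(A, B)` succeeds, over key generation and all coins: `B`, given
the public key, plays the verifier against the honest prover `q` times, and `A`, given the public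
key and the output of `B`, then plays the prover against the honest verifier. -/
def IdScheme.attackProb (D : PairingData p G₁ G₂) (S : IdScheme) (q : ℕ) (α : List Bool)
    (A B : Machine) : ℝ :=
  (((S.gen α).keys D).bind (fun k => (outputAfter D S.prover (k.1 ++ k.2) q B k.2).bind
    fun T => verdict D A S.verifier (k.2 ++ T) k.2) true).toReal

/-- Viability. -/
def IdScheme.IsViable (D : PairingData p G₁ G₂) (S : IdScheme) : Prop :=
  ∀ α, S.honestProb D α = 1

/-- Security against attacks `(A, B)` that run in total time at most `t`. -/
def IdScheme.IsSecure (D : PairingData p G₁ G₂) (S : IdScheme) (t : ℝ) (q : ℕ) (ε : ℝ) : Prop :=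
  ∀ (α : List Bool) (B A : Machine), ((A.time D.cost + B.time D.cost : ℕ) : ℝ) ≤ t →
    S.attackProb D q α A B < ε

/-- `(t, q, ε)`-identification schemes. -/
structure IdScheme.IsIdentificationScheme (D : PairingData p G₁ G₂) (S : IdScheme) (t : ℝ) (q : ℕ)
    (ε : ℝ) : Prop where
  gen_poly : ∃ f : Polynomial ℕ, ∀ α, codeTime D.cost (S.gen α).code ≤ f.eval α.length
  prover_time : (S.prover.time D.cost : ℝ) ≤ t
  verifier_time : (S.verifier.time D.cost : ℝ) ≤ t
  viable : S.IsViable D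
  secure : S.IsSecure D t q ε

/-! ### One-way pairings -/

/-- An algorithm that computes an element of `G₁`, found in the register `out`. -/
structure Inverter where
  code : List Instr
  out : ℕ

/-- The probability that `C`, on random inputs `g` and `x`, computes some `h` with `e(g, h) = x`. -/
def Inverter.successProb (D : PairingData p G₁ G₂) (C : Inverter) : ℝ :=
  ((PMF.uniformOfFintype (G₁ × G₂)).bind (fun gx =>
    (runCode D C.code [.el1 gx.1, .el2 gx.2]).map
      fun σ => D.e gx.1 (reg σ C.out).toG1 = gx.2) True).toReal

/-- `(t, ε)`-one-way pairings. -/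
def PairingData.IsOneWay (D : PairingData p G₁ G₂) (t ε : ℝ) : Prop :=
  ∀ C : Inverter, (codeTime D.cost C.code : ℝ) ≤ t → C.successProb D < ε

end Schemes

/-! ### The protocol -/

/-- The identification protocol based on the pairing as a one-way function.  The comments name the
content of the registers, in order. -/
def owfScheme : IdScheme where
  gen _ :=
    { code := [
        .op .sample1 0 0, -- 0: P
        .op .sample1 0 0, -- 1: Q
        .op .sample2 0 0, -- 2: y
        .op .sampleU 0 0, -- 3: s
        .op .pair 0 1, -- 4: e(P, Q)
        .op .inv2 4 0, -- 5: e(P, Q)⁻¹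
        .op .pow2 2 3, -- 6: y ^ s
        .op .inv2 6 0, -- 7: y ^ (-s)
        .op .mul2 5 7] -- 8: v
      secretKey := [1, 3] -- Q, s
      publicKey := [0, 2, 8] } -- P, y, v
  -- initial registers 0: Q, 1: s, 2: P, 3: y, 4: v
  prover := [
    { recv := 0
      code := [
        .op .sample1 0 0, -- 5: R
        .op .sampleZ 0 0, -- 6: r
        .op .pair 2 5, -- 7: e(P, R)
        .op .pow2 3 6, -- 8: y ^ r
        .op .mul2 7 8] -- 9: x
      send := [9] },
    { recv := 1 -- 10: m
      code := [
        .op .pow1 0 10, -- 11: Q ^ m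
        .op .mul1 5 11, -- 12: T
        .op .mulZ 10 1, -- 13: m s
        .op .addZ 6 13] -- 14: a
      send := [12, 14] }]
  -- initial registers 0: P, 1: y, 2: v
  verifier := [
    { recv := 1 -- 3: x
      code := [
        .op .sampleU 0 0] -- 4: m
      send := [4] },
    { recv := 2 -- 5: T, 6: a
      code := [
        .op .pair 0 5, -- 7: e(P, T)
        .op .pow2 1 6, -- 8: y ^ a
        .op .mul2 7 8, -- 9: e(P, T) y ^ a
        .op .pow2 2 4, -- 10: v ^ m
        .op .mul2 9 10, -- 11: e(P, T) y ^ a v ^ m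
        .op .eq 11 3] -- 12: the verdict
      send := [12] }]

end PairingId

end

open PairingId

noncomputable section

namespace PairingId

open scoped ENNReal

/-! ### Finite probability -/

section Probability

/-! The key $v^{-1}=e(P,Q)y^s$ hides $s$. If $P\ne1$, then $e(P,\cdot)$ is onto, so every $s$ occurs
in some secret key for $v$. Conversations with the prover do not reveal which one it holds:
replacing $(Q,s)$ by $(Q',s')$ is compensated, for any challenge $m$, by the shift $R\mapsto
R(Q/Q')^m$, $r\mapsto r+m(s-s')$, which keeps $x$, the response and the law of $(R,r)$
(`outputAfter_congr`).

The inverter, given $(P,y)$, makes its own key pair, plays the prover for $\mathcal B$, runs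
$\mathcal A$ up to its first message, and runs the second move of $\mathcal A$ twice from the same
state with independent challenges. By Jensen both conversations are accepted with probability at
least $\epsilon^2$ (`sq_attack_le_fork`). If the challenges differ, division of the two verification
equations gives $(E,\sigma)$ with $e(P,E)y^\sigma=e(P,Q)y^s$; if moreover $\sigma\ne s$, then
$(E/Q)^{1/(s-\sigma)}$ is a preimage of $y$ (`e_extract`). What can go wrong is $P=1$, equal
challenges, or $\sigma=s$; the last is unlikely because $s$ is hidden (`prob_scalar_eq`). So the
inverter succeeds with probability at least $\epsilon^2-1/p-2/(p-1)$ (`sq_attack_le`).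

This loss is harmless if $\epsilon^2/9>1/p$; otherwise a random guess, which succeeds with
probability exactly $1/p$, is good enough (`exists_inverter`).

That the inverter is a straight-line program of the right cost is proved by compiling interactive
machines into one program with renamed registers (`run_compileInteract`, `run_compileOutput`,
`codeTime_attackInverter`). -/

theorem bind_congr_support {α β : Type*} {μ : PMF α} {f g : α → PMF β}
    (h : ∀ a ∈ μ.support, f a = g a) : μ.bind f = μ.bind g := by
  ext b
  rw [PMF.bind_apply, PMF.bind_apply]
  refine tsum_congr fun a => ?_
  by_cases ha : a ∈ μ.support
  · rw [h a ha]
  · rw [PMF.mem_support_iff, not_not] at ha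
    simp [ha]

theorem map_congr_support {α β : Type*} {μ : PMF α} {f g : α → β}
    (h : ∀ a ∈ μ.support, f a = g a) : μ.map f = μ.map g :=
  bind_congr_support fun a ha => by simp [h a ha]

/-- Probability of an event. -/
def prob {α : Type*} (μ : PMF α) (E : α → Prop) : ℝ≥0∞ := μ.toOuterMeasure {a | E a}

theorem prob_eq_map {α : Type*} (μ : PMF α) (E : α → Prop) : prob μ E = μ.map E True := by
  rw [prob, ← PMF.toOuterMeasure_apply_singleton, PMF.toOuterMeasure_map_apply]
  congr 1
  ext a
  simp

theorem prob_le_one {α : Type*} (μ : PMF α) (E : α → Prop) : prob μ E ≤ 1 := by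
  rw [prob_eq_map]
  exact PMF.coe_le_one _ _

theorem prob_mono {α : Type*} (μ : PMF α) {E F : α → Prop} (h : ∀ a, E a → F a) :
    prob μ E ≤ prob μ F := MeasureTheory.measure_mono fun a ha => h a ha

theorem prob_or_le {α : Type*} (μ : PMF α) (E F : α → Prop) :
    prob μ (fun a => E a ∨ F a) ≤ prob μ E + prob μ F := MeasureTheory.measure_union_le _ _

theorem prob_bind {α β : Type*} (μ : PMF α) (f : α → PMF β) (E : β → Prop) :
    prob (μ.bind f) E = ∑' a, μ a * prob (f a) E := PMF.toOuterMeasure_bind_apply _ _ _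

theorem prob_map {α β : Type*} (μ : PMF α) (f : α → β) (E : β → Prop) :
    prob (μ.map f) E = prob μ (fun a => E (f a)) := by
  rw [prob_eq_map, prob_eq_map, PMF.map_comp]
  rfl

theorem prob_pure {α : Type*} (a : α) (E : α → Prop) [Decidable (E a)] :
    prob (PMF.pure a) E = if E a then 1 else 0 := by
  rw [prob, PMF.toOuterMeasure_pure_apply]
  by_cases h : E a <;> simp [h]

theorem prob_bind_le {α β : Type*} (μ : PMF α) (f : α → PMF β) (E : β → Prop) {c : ℝ≥0∞}
    (h : ∀ a, prob (f a) E ≤ c) : prob (μ.bind f) E ≤ c := by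
  rw [prob_bind]
  calc ∑' a, μ a * prob (f a) E ≤ ∑' a, μ a * c := by gcongr; exact h _
    _ = c := by rw [ENNReal.tsum_mul_right, μ.tsum_coe, one_mul]

theorem prob_bind_eq_const {α β : Type*} (μ : PMF α) (f : α → PMF β) (E : β → Prop) {c : ℝ≥0∞}
    (h : ∀ a, prob (f a) E = c) : prob (μ.bind f) E = c := by
  rw [prob_bind]
  simp_rw [h]
  rw [ENNReal.tsum_mul_right, μ.tsum_coe, one_mul]

theorem prob_uniform_eq {α : Type*} [Fintype α] [Nonempty α] (a : α) :
    prob (PMF.uniformOfFintype α) (fun b => b = a) = (Fintype.card α : ℝ≥0∞)⁻¹ := by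
  rw [prob, Set.ofPred_eq_eq_singleton, PMF.toOuterMeasure_apply_singleton,
    PMF.uniformOfFintype_apply]

/-- Jensen's inequality for the square. -/
theorem sq_tsum_mul_le {α : Type*} (μ : PMF α) (f : α → ℝ≥0∞) (hf : ∀ a, f a ≤ 1) :
    (∑' a, μ a * f a) ^ 2 ≤ ∑' a, μ a * f a ^ 2 := by
  -- This inequality is averaged over an independent pair $(a,b)$. The bound `hf` only provides
  -- finiteness.
  have key : ∀ a b, 2 * (f a * f b) ≤ f a ^ 2 + f b ^ 2 := fun a b => by
    have ha : f a ≠ ⊤ := ne_top_of_le_ne_top ENNReal.one_ne_top (hf a)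
    have hb : f b ≠ ⊤ := ne_top_of_le_ne_top ENNReal.one_ne_top (hf b)
    lift f a to NNReal using ha with x
    lift f b to NNReal using hb with y
    norm_cast
    rw [← NNReal.coe_le_coe]
    push_cast
    nlinarith [sq_nonneg ((x : ℝ) - y)]
  have h1 : 2 * (∑' a, μ a * f a) ^ 2 = ∑' a, ∑' b, μ a * μ b * (2 * (f a * f b)) := by
    rw [sq, ← ENNReal.tsum_mul_right, ← ENNReal.tsum_mul_left]
    refine tsum_congr fun a => ?_
    rw [← ENNReal.tsum_mul_left, ← ENNReal.tsum_mul_left]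
    exact tsum_congr fun b => by ring
  have h2 : ∑' a, ∑' b, μ a * μ b * (f a ^ 2 + f b ^ 2) = 2 * ∑' a, μ a * f a ^ 2 := by
    have e1 : ∀ a, ∑' b, μ a * μ b * (f a ^ 2 + f b ^ 2) =
        μ a * f a ^ 2 + μ a * ∑' b, μ b * f b ^ 2 := fun a => by
      rw [← ENNReal.tsum_mul_left]
      calc ∑' b, μ a * μ b * (f a ^ 2 + f b ^ 2)
          = ∑' b, (μ a * f a ^ 2 * μ b + μ a * (μ b * f b ^ 2)) := tsum_congr fun b => by ring
        _ = _ := by rw [ENNReal.tsum_add, ENNReal.tsum_mul_left, μ.tsum_coe, mul_one]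
    simp_rw [e1]
    rw [ENNReal.tsum_add, ENNReal.tsum_mul_right, μ.tsum_coe, one_mul, two_mul]
  refine (ENNReal.mul_le_mul_iff_right (a := 2) (by norm_num) (by norm_num)).1 ?_
  rw [h1, ← h2]
  gcongr
  exact key _ _

/-- Two independent samples satisfy `E c`. -/
theorem prob_bind_map_and {α γ : Type*} (μ : PMF α) (E : γ → α → Prop) (c : γ) :
    prob (μ.bind fun a => μ.map fun b => (c, a, b)) (fun f => E f.1 f.2.1 ∧ E f.1 f.2.2) =
      prob μ (E c) ^ 2 := by
  classical
  have h : ∀ a, prob (μ.map fun b => (c, a, b)) (fun f => E f.1 f.2.1 ∧ E f.1 f.2.2) =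
      prob (PMF.pure a) (E c) * prob μ (E c) := fun a => by
    rw [prob_map, prob_pure]
    by_cases ha : E c a
    · simp [ha]
    · simp [ha, prob]
  rw [prob_bind, sq]
  simp_rw [h, ← mul_assoc]
  rw [ENNReal.tsum_mul_right, ← prob_bind, PMF.bind_pure]

theorem map_fun_const {α β : Type*} (μ : PMF α) (b : β) : (μ.map fun _ => b) = PMF.pure b :=
  PMF.map_const _ _

theorem uniform_prod {α β : Type*} [Fintype α] [Nonempty α] [Fintype β] [Nonempty β] :
    PMF.uniformOfFintype (α × β) = (PMF.uniformOfFintype α).bind fun a =>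
      (PMF.uniformOfFintype β).map fun b => (a, b) := by
  classical
  ext ⟨a, b⟩
  rw [PMF.bind_apply, tsum_eq_single a, PMF.map_apply, tsum_eq_single b]
  · simp [ENNReal.mul_inv]
  · intro b' hb
    simp [hb.symm]
  · intro a' ha
    rw [PMF.map_apply]
    simp [ha.symm]

theorem uniform_map_equiv {α : Type*} [Fintype α] [Nonempty α] (e : α ≃ α) :
    (PMF.uniformOfFintype α).map e = PMF.uniformOfFintype α := by
  classical
  ext b
  rw [PMF.map_apply, tsum_eq_single (e.symm b)]
  · simp
  · intro a ha
    rw [if_neg]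
    rintro rfl
    simp at ha

theorem uniform_bind_equiv {α β : Type*} [Fintype α] [Nonempty α] (e : α ≃ α) (f : α → PMF β) :
    ((PMF.uniformOfFintype α).bind fun a => f (e a)) = (PMF.uniformOfFintype α).bind f := by
  conv_rhs => rw [← uniform_map_equiv e, PMF.bind_map]
  rfl

/-- If an intermediate message depends on `a` through `x a` only, then `a` may be reindexed after
that message, as long as `x` does not change. -/
theorem uniform_bind_reindex {α β γ X : Type*} [Fintype α] [Nonempty α] (x : α → X)
    (κ : X → PMF β) (f f' : α → β → PMF γ) (e : β → α ≃ α) (hx : ∀ b a, x (e b a) = x a)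
    (hf : ∀ b a, f' (e b a) b = f a b) :
    ((PMF.uniformOfFintype α).bind fun a => (κ (x a)).bind (f a)) =
      (PMF.uniformOfFintype α).bind fun a => (κ (x a)).bind (f' a) := by
  ext c
  simp only [PMF.bind_apply, PMF.uniformOfFintype_apply, ← ENNReal.tsum_mul_left]
  -- With the message `b` summed on the outside, the permutation `e b` of the inner sum may depend
  -- on it.
  rw [ENNReal.tsum_comm]
  conv_rhs => rw [ENNReal.tsum_comm]
  refine tsum_congr fun b => ?_
  rw [← (e b).tsum_eq fun a => (Fintype.card α : ℝ≥0∞)⁻¹ * (κ (x a) b * f' a b c)]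
  simp only [hx, hf]

end Probability

/-! ### Cyclic groups of prime order -/

section Groups

variable {p : ℕ} {G₁ G₂ : Type*} [CommGroup G₁] [CommGroup G₂]

/-- A discrete logarithm turns identities in $\mathbb G_2$ into linear identities over the field
$\mathbb Z/p$, where `ring` and `linear_combination` apply and exponents `a.val` become scalars `a`.
-/
theorem exists_log [Fact p.Prime] [IsCyclic G₂] (h : Nat.card G₂ = p) :
    ∃ log : G₂ → ZMod p, Function.Injective log ∧
    (∀ x y, log (x * y) = log x + log y) ∧ (∀ x, log x⁻¹ = -log x) ∧
    ∀ x (a : ZMod p), log (x ^ a.val) = a * log x := by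
  let φ : G₂ ≃* Multiplicative (ZMod p) := mulEquivOfCyclicCardEq (by simp [h])
  refine ⟨fun x => (φ x).toAdd, fun x y hxy => φ.injective (Multiplicative.toAdd.injective hxy),
    fun x y => by simp, fun x => by simp, fun x a => by simp⟩

variable {D : PairingData p G₁ G₂}

/-- The bilinearity axiom speaks of powers only, so all three elements are written as powers of one
generator. -/
theorem PairingData.IsCryptographicPairing.e_mul [IsCyclic G₁] (hD : D.IsCryptographicPairing)
    (P Q R : G₁) : D.e P (Q * R) = D.e P Q * D.e P R := by
  obtain ⟨g, hg⟩ := IsCyclic.exists_generator (α := G₁)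
  obtain ⟨a, rfl⟩ := hg P
  obtain ⟨b, rfl⟩ := hg Q
  obtain ⟨c, rfl⟩ := hg R
  simp only [← zpow_add, hD.bilinear, mul_add]

theorem PairingData.IsCryptographicPairing.e_pow (hD : D.IsCryptographicPairing) (P Q : G₁)
    (n : ℕ) : D.e P (Q ^ n) = D.e P Q ^ n := by
  have := hD.bilinear P Q 1 n
  simpa using this

theorem PairingData.IsCryptographicPairing.e_inv (hD : D.IsCryptographicPairing) (P Q : G₁) :
    D.e P Q⁻¹ = (D.e P Q)⁻¹ := by
  have := hD.bilinear P Q 1 (-1)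
  simpa using this

theorem PairingData.IsCryptographicPairing.e_surjective [Fact p.Prime]
    (hD : D.IsCryptographicPairing) {P : G₁} (hP : P ≠ 1) :
    Function.Surjective (D.e P) := by
  intro z
  have hgen : ∀ x, x ∈ Subgroup.zpowers P := fun x =>
    mem_zpowers_of_prime_card hD.card_left hP
  obtain ⟨k, rfl⟩ := hD.nondegenerate P hgen z
  exact ⟨P ^ k, by simpa using hD.bilinear P P 1 k⟩

end Groups

/-! ### Programs that simulate interactive machines

A machine whose registers are scattered over those of a larger program is simulated by renaming
registers.  The list `L` says where its registers are; `z` is a register containing the bit `0`,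
which takes the place of registers that do not exist. -/

def Instr.rename (f : ℕ → ℕ) : Instr → Instr
  | .const b => .const b
  | .nand i j => .nand (f i) (f j)
  | .coin => .coin
  | .sel c i j => .sel (f c) (f i) (f j)
  | .getBit k i => .getBit k (f i)
  | .pack1 l => .pack1 (l.map f)
  | .pack2 l => .pack2 (l.map f)
  | .packZ l => .packZ (l.map f)
  | .op o i j => .op o (f i) (f j)

theorem Instr.time_rename (cost : Op → ℕ) (f : ℕ → ℕ) (i : Instr) :
    (i.rename f).time cost = i.time cost := by
  cases i <;> simp [Instr.rename, Instr.time]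

theorem codeTime_append (cost : Op → ℕ) (c d : List Instr) :
    codeTime cost (c ++ d) = codeTime cost c + codeTime cost d := by
  simp [codeTime]

/-- The program `c` for a machine with registers at `L`, run when there are `n` registers. -/
def relocate (z : ℕ) : (L : List ℕ) → (n : ℕ) → List Instr → List Instr
  | _, _, [] => []
  | L, n, i :: c => i.rename (fun j => L.getD j z) :: relocate z (L ++ [n]) (n + 1) c

theorem length_relocate (z : ℕ) (L : List ℕ) (n : ℕ) (c : List Instr) :
    (relocate z L n c).length = c.length := by
  induction c generalizing L n with
  | nil => rfl
  | cons i c ih => simp [relocate, ih]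

theorem codeTime_relocate (cost : Op → ℕ) (z : ℕ) (L : List ℕ) (n : ℕ) (c : List Instr) :
    codeTime cost (relocate z L n c) = codeTime cost c := by
  induction c generalizing L n with
  | nil => rfl
  | cons i c ih =>
    have := ih (L ++ [n]) (n + 1)
    simp only [codeTime] at this
    simp [relocate, codeTime, Instr.time_rename, this]

/-- A register number beyond the current length reads as the bit `0` now but may be filled later.
Only for bounded lists are the contents stable when the program continues. -/
def Bounded (n : ℕ) (L : List ℕ) : Prop := ∀ l ∈ L, l < n

theorem Bounded.mono {n m : ℕ} {L : List ℕ} (h : Bounded n L) (hnm : n ≤ m) : Bounded m L :=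
  fun l hl => (h l hl).trans_le hnm

theorem Bounded.append {n : ℕ} {L M : List ℕ} (h : Bounded n L) (h' : Bounded n M) :
    Bounded n (L ++ M) := fun l hl => (List.mem_append.1 hl).elim (h l) (h' l)

theorem Bounded.getD {n z : ℕ} {L : List ℕ} (h : Bounded n L) (hz : z < n) (j : ℕ) :
    L.getD j z < n := by
  rw [List.getD_eq_getElem?_getD]
  by_cases hj : j < L.length
  · rw [List.getElem?_eq_getElem hj]
    exact h _ (List.getElem_mem hj)
  · rw [List.getElem?_eq_none (not_lt.1 hj)]
    exact hz

theorem Bounded.map_getD {n z : ℕ} {L : List ℕ} (h : Bounded n L) (hz : z < n) (l : List ℕ) :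
    Bounded n (l.map (L.getD · z)) := fun x hx => by
  obtain ⟨j, -, rfl⟩ := List.mem_map.1 hx
  exact h.getD hz j

theorem bounded_range' (n k : ℕ) : Bounded (n + k) (List.range' n k) := fun l hl => by
  have := List.mem_range'_1.1 hl
  omega

/-- Locations of the registers of a machine after it has received a message located at `M`. -/
def Phase.inputs (z : ℕ) (φ : Phase) (M L : List ℕ) : List ℕ :=
  L ++ (List.range φ.recv).map (M.getD · z)

def Phase.compile (z n : ℕ) (φ : Phase) (M L : List ℕ) : List Instr :=
  relocate z (φ.inputs z M L) n φ.code

/-- Locations of the registers after a move. -/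
def Phase.regs (z n : ℕ) (φ : Phase) (M L : List ℕ) : List ℕ :=
  φ.inputs z M L ++ List.range' n φ.code.length

/-- Location of the message sent. -/
def Phase.out (z n : ℕ) (φ : Phase) (M L : List ℕ) : List ℕ :=
  φ.send.map ((φ.regs z n M L).getD · z)

/-- Simulation of `interact`: the code and the locations of its three results. -/
def compileInteract (z : ℕ) : ℕ → Machine → Machine → (n : ℕ) → (msg L L' : List ℕ) →
    List Instr × List ℕ × List ℕ × List ℕ
  | 0, _, _, _, msg, L, L' => ([], L, L', msg)
  | k + 1, M, N, n, msg, L, L' =>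
    let φ := M.headD .idle
    let ψ := N.headD .idle
    let n₁ := n + φ.code.length
    let m₁ := φ.out z n msg L
    let r := compileInteract z k M.tail N.tail (n₁ + ψ.code.length) (ψ.out z n₁ m₁ L')
      (φ.regs z n msg L) (ψ.regs z n₁ m₁ L')
    (φ.compile z n msg L ++ (ψ.compile z n₁ m₁ L' ++ r.1), r.2)

/-- Simulation of `outputAfter`: the code and the location of the output. -/
def compileOutput (z : ℕ) (P : Machine) (S : List ℕ) : ℕ → Machine → (n : ℕ) → (L : List ℕ) →
    List Instr × List ℕ
  | 0, B, n, L => ((B.headD .idle).compile z n [] L, (B.headD .idle).out z n [] L)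
  | q + 1, B, n, L =>
    let r := compileInteract z P.length P B n [] S L
    let r' := compileOutput z P S q (B.drop P.length) (n + r.1.length) r.2.2.1
    (r.1 ++ r'.1, r'.2)

theorem Phase.length_compile (z n : ℕ) (φ : Phase) (M L : List ℕ) :
    (φ.compile z n M L).length = φ.code.length := length_relocate _ _ _ _

theorem Phase.codeTime_compile (cost : Op → ℕ) (z n : ℕ) (φ : Phase) (M L : List ℕ) :
    codeTime cost (φ.compile z n M L) = codeTime cost φ.code := codeTime_relocate _ _ _ _ _

theorem Machine.time_cons (cost : Op → ℕ) (φ : Phase) (M : Machine) :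
    Machine.time cost (φ :: M) = codeTime cost φ.code + Machine.time cost M := by
  simp [Machine.time]

theorem Machine.time_headD_tail (cost : Op → ℕ) (M : Machine) :
    codeTime cost (M.headD .idle).code + Machine.time cost M.tail = Machine.time cost M := by
  cases M with
  | nil => simp [Phase.idle, codeTime, Machine.time]
  | cons φ M => rw [Machine.time_cons]; rfl

/-- The unused moves are kept in the balance so that the equation can be chained over the
consecutive interactions of one machine. -/
theorem codeTime_compileInteract (cost : Op → ℕ) (z k : ℕ) (M N : Machine) (n : ℕ)
    (msg L L' : List ℕ) :
    codeTime cost (compileInteract z k M N n msg L L').1 + Machine.time cost (M.drop k) +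
      Machine.time cost (N.drop k) = Machine.time cost M + Machine.time cost N := by
  induction k generalizing M N n msg L L' with
  | zero => simp [compileInteract, codeTime]
  | succ k ih =>
    simp only [compileInteract, codeTime_append, Phase.codeTime_compile]
    rw [← Machine.time_headD_tail cost M, ← Machine.time_headD_tail cost N,
      ← List.drop_tail, ← List.drop_tail]
    have := ih M.tail N.tail (n + (M.headD .idle).code.length + (N.headD .idle).code.length)
      ((N.headD .idle).out z (n + (M.headD .idle).code.length) ((M.headD .idle).out z n msg L) L')
      ((M.headD .idle).regs z n msg L)
      ((N.headD .idle).regs z (n + (M.headD .idle).code.length)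
        ((M.headD .idle).out z n msg L) L')
    omega

theorem codeTime_compileOutput (cost : Op → ℕ) (z : ℕ) (P : Machine) (S : List ℕ) (q : ℕ)
    (B : Machine) (n : ℕ) (L : List ℕ) :
    codeTime cost (compileOutput z P S q B n L).1 ≤
      Machine.time cost P * q + Machine.time cost B := by
  induction q generalizing B n L with
  | zero =>
    simp only [compileOutput, Phase.codeTime_compile]
    have := Machine.time_headD_tail cost B
    omega
  | succ q ih =>
    simp only [compileOutput, codeTime_append]
    have h1 := codeTime_compileInteract cost z P.length P B n [] S L
    have h2 := ih (B.drop P.length) (n + (compileInteract z P.length P B n [] S L).1.length)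
      (compileInteract z P.length P B n [] S L).2.2.1
    rw [mul_add, mul_one]
    omega

/-! ### Compiled machines refer only to registers that exist. -/

section Bounds

variable {z n : ℕ}

theorem Phase.bounded_regs (hz : z < n) (φ : Phase) {M L : List ℕ} (hM : Bounded n M)
    (hL : Bounded n L) : Bounded (n + φ.code.length) (φ.regs z n M L) :=
  ((hL.append (hM.map_getD hz _)).mono (Nat.le_add_right _ _)).append (bounded_range' _ _)

theorem Phase.bounded_out (hz : z < n) (φ : Phase) {M L : List ℕ} (hM : Bounded n M)
    (hL : Bounded n L) : Bounded (n + φ.code.length) (φ.out z n M L) :=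
  (φ.bounded_regs hz hM hL).map_getD (by omega) _

theorem bounded_compileInteract (hz : z < n) (k : ℕ) (M N : Machine) {msg L L' : List ℕ}
    (hmsg : Bounded n msg) (hL : Bounded n L) (hL' : Bounded n L') :
    Bounded (n + (compileInteract z k M N n msg L L').1.length)
      (compileInteract z k M N n msg L L').2.2.1 := by
  induction k generalizing M N n msg L L' with
  | zero => simpa [compileInteract] using hL'
  | succ k ih =>
    simp only [compileInteract, List.length_append, Phase.length_compile]
    have h1 := (M.headD .idle).bounded_out hz hmsg hL
    have h2 := (M.headD .idle).bounded_regs hz hmsg hL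
    have hL1 := hL'.mono (Nat.le_add_right n (M.headD .idle).code.length)
    have hz1 : z < n + (M.headD .idle).code.length := by omega
    have := ih (by omega) M.tail N.tail ((N.headD .idle).bounded_out hz1 h1 hL1)
      (h2.mono (Nat.le_add_right _ _)) ((N.headD .idle).bounded_regs hz1 h1 hL1)
    rw [← add_assoc, ← add_assoc]
    exact this

theorem bounded_compileOutput (hz : z < n) (P : Machine) {S : List ℕ} (q : ℕ) (B : Machine)
    {L : List ℕ} (hS : Bounded n S) (hL : Bounded n L) :
    Bounded (n + (compileOutput z P S q B n L).1.length) (compileOutput z P S q B n L).2 := by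
  induction q generalizing B n L with
  | zero =>
    simp only [compileOutput, Phase.length_compile]
    exact Phase.bounded_out hz _ (by simp [Bounded]) hL
  | succ q ih =>
    simp only [compileOutput, List.length_append]
    rw [← add_assoc]
    exact ih (by omega) _ (hS.mono (Nat.le_add_right _ _))
      (bounded_compileInteract hz _ _ _ (by simp [Bounded]) hS hL)

end Bounds

/-! ### Correctness of the compilation, as equality of distributions. -/

section Simulation

variable {p : ℕ} {G₁ G₂ : Type*}

/-- The contents of the registers `L`. -/
def view (L : List ℕ) (σ : List (Val p G₁ G₂)) : List (Val p G₁ G₂) := L.map (reg σ)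

theorem reg_append {σ w : List (Val p G₁ G₂)} {i : ℕ} (h : i < σ.length) :
    reg (σ ++ w) i = reg σ i := by
  rw [reg, reg, List.getD_append _ _ _ _ h]

theorem reg_of_prefix {σ τ : List (Val p G₁ G₂)} (h : σ <+: τ) {i : ℕ} (hi : i < σ.length) :
    reg τ i = reg σ i := by
  obtain ⟨w, rfl⟩ := h
  exact reg_append hi

theorem view_of_prefix {σ τ : List (Val p G₁ G₂)} (h : σ <+: τ) {L : List ℕ}
    (hL : Bounded σ.length L) : view L τ = view L σ :=
  List.map_congr_left fun l hl => reg_of_prefix h (hL l hl)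

theorem view_append (L M : List ℕ) (σ : List (Val p G₁ G₂)) :
    view (L ++ M) σ = view L σ ++ view M σ := List.map_append

theorem reg_view {σ : List (Val p G₁ G₂)} {z : ℕ} (hz : reg σ z = .bit false) (L : List ℕ)
    (j : ℕ) : reg (view L σ) j = reg σ (L.getD j z) := by
  rw [reg, view, ← hz, List.getD_map]

theorem view_map_getD {σ : List (Val p G₁ G₂)} {z : ℕ} (hz : reg σ z = .bit false)
    (L l : List ℕ) : view (l.map (L.getD · z)) σ = l.map (reg (view L σ)) := by
  rw [view, List.map_map]
  exact List.map_congr_left fun j _ => (reg_view hz L j).symm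

variable [Fact p.Prime] [CommGroup G₁] [Fintype G₁] [CommGroup G₂] [Fintype G₂]
  (D : PairingData p G₁ G₂)

theorem Instr.eval_rename {σ τ : List (Val p G₁ G₂)} {f : ℕ → ℕ}
    (h : ∀ i, reg σ (f i) = reg τ i) (i : Instr) : (i.rename f).eval D σ = i.eval D τ := by
  cases i <;> simp [Instr.rename, Instr.eval, h, readNat, Function.comp_def]

theorem prefix_of_mem_support_runCode {c : List Instr} {σ τ : List (Val p G₁ G₂)}
    (h : τ ∈ (runCode D c σ).support) : σ <+: τ ∧ τ.length = σ.length + c.length := by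
  induction c generalizing σ with
  | nil =>
    rw [runCode, PMF.support_pure, Set.mem_singleton_iff] at h
    simp [h]
  | cons i c ih =>
    rw [runCode, PMF.mem_support_bind_iff] at h
    obtain ⟨v, -, hv⟩ := h
    obtain ⟨h1, h2⟩ := ih hv
    refine ⟨(List.prefix_append _ _).trans h1, ?_⟩
    rw [h2]
    simp
    omega

theorem runCode_append (c d : List Instr) (σ : List (Val p G₁ G₂)) :
    runCode D (c ++ d) σ = (runCode D c σ).bind (runCode D d) := by
  induction c generalizing σ with
  | nil => simp [runCode]
  | cons i c ih => simp [runCode, ih]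

/-- This cuts a simulation into moves: if the observed result of `d` depends on the intermediate
registers only through `V`, the two stages compose like a Markov chain. -/
theorem map_runCode_append {α β : Type*} {c d : List Instr} {σ : List (Val p G₁ G₂)}
    {V : List (Val p G₁ G₂) → α} {W : List (Val p G₁ G₂) → β} {κ : α → PMF β}
    (h : ∀ τ, σ <+: τ → τ.length = σ.length + c.length → (runCode D d τ).map W = κ (V τ)) :
    (runCode D (c ++ d) σ).map W = ((runCode D c σ).map V).bind κ := by
  rw [runCode_append, PMF.map_bind, PMF.bind_map]
  refine bind_congr_support fun τ hτ => ?_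
  obtain ⟨h1, h2⟩ := prefix_of_mem_support_runCode D hτ
  exact h τ h1 h2

variable {z : ℕ} {σ : List (Val p G₁ G₂)}

/-- Each instruction appends one register to both executions, so the simulated machine's new
register is the last one of the large program and its number is appended to `L`. -/
theorem runCode_relocate (hz : reg σ z = .bit false) (hzn : z < σ.length) {L : List ℕ}
    (hL : Bounded σ.length L) (c : List Instr) :
    (runCode D (relocate z L σ.length c) σ).map (view (L ++ List.range' σ.length c.length)) =
      runCode D c (view L σ) := by
  induction c generalizing σ L with
  | nil => simp [relocate, runCode, PMF.pure_map]
  | cons i c ih =>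
    rw [relocate, runCode, runCode, PMF.map_bind,
      Instr.eval_rename D (fun j => (reg_view hz L j).symm)]
    congr 1
    funext v
    have hlen : (σ ++ [v]).length = σ.length + 1 := by simp
    have hb : Bounded (σ.length + 1) (L ++ [σ.length]) :=
      (hL.mono (Nat.le_succ _)).append (by simp [Bounded])
    have := ih (σ := σ ++ [v]) (L := L ++ [σ.length]) (by rw [reg_append hzn, hz])
      (by omega) (by rwa [hlen])
    rw [hlen] at this
    rw [List.length_cons, List.range'_succ, ← List.singleton_append, ← List.append_assoc, this,
      view_append, view_of_prefix (List.prefix_append _ _) hL]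
    congr 2
    simp [view, reg]

theorem Phase.run_compile (hz : reg σ z = .bit false) (hzn : z < σ.length) (φ : Phase)
    {M L : List ℕ} (hM : Bounded σ.length M) (hL : Bounded σ.length L) :
    (runCode D (φ.compile z σ.length M L) σ).map
      (fun τ => (view (φ.regs z σ.length M L) τ, view (φ.out z σ.length M L) τ)) =
      φ.run D (view M σ) (view L σ) := by
  have hin : view (φ.inputs z M L) σ = view L σ ++ (List.range φ.recv).map (reg (view M σ)) := by
    rw [Phase.inputs, view_append, view_map_getD hz]
  rw [Phase.run, ← hin, ← runCode_relocate D hz hzn (L := φ.inputs z M L)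
    (hL.append (hM.map_getD hzn _)), PMF.map_comp]
  refine map_congr_support fun τ hτ => ?_
  obtain ⟨h1, -⟩ := prefix_of_mem_support_runCode D hτ
  rw [Phase.out, view_map_getD (by rw [reg_of_prefix h1 hzn, hz])]
  rfl

theorem run_compileInteract (hz : reg σ z = .bit false) (hzn : z < σ.length) (k : ℕ)
    (M N : Machine) {msg L L' : List ℕ} (hmsg : Bounded σ.length msg) (hL : Bounded σ.length L)
    (hL' : Bounded σ.length L') :
    (runCode D (compileInteract z k M N σ.length msg L L').1 σ).map
      (fun τ => (view (compileInteract z k M N σ.length msg L L').2.1 τ,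
        view (compileInteract z k M N σ.length msg L L').2.2.1 τ,
        view (compileInteract z k M N σ.length msg L L').2.2.2 τ)) =
      interact D k M N (view msg σ) (view L σ) (view L' σ) := by
  induction k generalizing M N σ msg L L' with
  | zero => simp [compileInteract, runCode, interact, PMF.pure_map]
  | succ k ih =>
    simp only [compileInteract]
    rw [interact, ← Phase.run_compile D hz hzn _ hmsg hL]
    refine map_runCode_append D fun τ hτ hn => ?_
    rw [Phase.length_compile] at hn
    have hzτ : reg τ z = .bit false := by rw [reg_of_prefix hτ hzn, hz]
    have b1 := (M.headD .idle).bounded_out hzn hmsg hL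
    have b2 := (M.headD .idle).bounded_regs hzn hmsg hL
    have b3 := hL'.mono (Nat.le_add_right _ (M.headD .idle).code.length)
    rw [← hn] at b1 b2 b3
    have hzn' : z < τ.length := by omega
    dsimp only
    rw [← view_of_prefix hτ hL', ← Phase.run_compile D hzτ hzn' _ b1 b3,
      ← hn]
    refine map_runCode_append D fun ρ hρ hn' => ?_
    rw [Phase.length_compile] at hn'
    have hzρ : reg ρ z = .bit false := by rw [reg_of_prefix hρ hzn', hzτ]
    have b4 := (N.headD .idle).bounded_out hzn' b1 b3
    have b5 := (N.headD .idle).bounded_regs hzn' b1 b3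
    have b6 := b2.mono (Nat.le_add_right _ (N.headD .idle).code.length)
    rw [← hn'] at b4 b5 b6
    rw [← hn', ih hzρ (by omega) _ _ b4 b6 b5]
    dsimp only
    rw [view_of_prefix hρ b2]

theorem run_compileOutput (hz : reg σ z = .bit false) (hzn : z < σ.length) (P : Machine)
    {S : List ℕ} (q : ℕ) (B : Machine) {L : List ℕ} (hS : Bounded σ.length S)
    (hL : Bounded σ.length L) :
    (runCode D (compileOutput z P S q B σ.length L).1 σ).map
      (view (compileOutput z P S q B σ.length L).2) =
      outputAfter D P (view S σ) q B (view L σ) := by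
  induction q generalizing B σ L with
  | zero =>
    have := Phase.run_compile D hz hzn (B.headD .idle) (M := []) (by simp [Bounded]) hL
    rw [show view [] σ = [] from rfl] at this
    rw [outputAfter, ← this, PMF.map_comp]
    rfl
  | succ q ih =>
    simp only [compileOutput]
    rw [outputAfter]
    have := run_compileInteract D hz hzn P.length P B (msg := []) (by simp [Bounded]) hS hL
    rw [show view [] σ = [] from rfl] at this
    rw [← this]
    refine map_runCode_append D fun τ hτ hn => ?_
    have b := bounded_compileInteract hzn P.length P B (msg := []) (by simp [Bounded]) hS hL
    have b' := hS.mono (Nat.le_add_right _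
      (compileInteract z P.length P B σ.length [] S L).1.length)
    rw [← hn] at b b'
    rw [← hn, ih (by rw [reg_of_prefix hτ hzn, hz]) (by omega) _ b' b, view_of_prefix hτ hS]

end Simulation

/-! ### The reduction -/

/-- Pick a challenge. -/
def challengePhase : Phase := ⟨0, [.op .sampleU 0 0], [0]⟩

/-- Compute a preimage of `y` from the registers 0: `Q`, 1: `s` and the challenges (2, 3) and
responses (4, 5 and 6, 7) of two accepted conversations with the same first message. -/
def extractPhase : Phase where
  recv := 0
  code := [
    .op .negZ 3 0,
    .op .addZ 2 8,
    .op .invZ 9 0,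
    .op .inv1 6 0,
    .op .mul1 4 11,
    .op .pow1 12 10,
    .op .inv1 0 0,
    .op .mul1 13 14,
    .op .negZ 7 0,
    .op .addZ 5 16,
    .op .mulZ 10 17,
    .op .negZ 18 0,
    .op .addZ 1 19,
    .op .invZ 20 0,
    .op .pow1 15 21]
  send := [22]

/-- Generate a key pair for given `P` and `y`: 3 and 4 contain the secret key, 0, 1 and 9 the public
key, and 2 the bit `0`. -/
def rekeyCode : List Instr := [
  .const false,
  .op .sample1 0 0,
  .op .sampleU 0 0,
  .op .pair 0 3,
  .op .inv2 5 0,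
  .op .pow2 1 4,
  .op .inv2 7 0,
  .op .mul2 6 8]

/-- Two challenges and responses for a prover with registers `L` whose next move is `φ`, followed by
the extraction of a preimage. -/
def forkInverter (φ : Phase) (n : ℕ) (L : List ℕ) : Inverter :=
  let m₁ := challengePhase.out 2 n [] []
  let n₁ := n + 1
  let r₁ := φ.out 2 n₁ m₁ L
  let n₂ := n₁ + φ.code.length
  let m₂ := challengePhase.out 2 n₂ [] []
  let n₃ := n₂ + 1
  -- The rewinding: `L` still gives the state before the first response, since registers are never
  -- overwritten.
  let r₂ := φ.out 2 n₃ m₂ L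
  let n₄ := n₃ + φ.code.length
  let M := [3, 4, m₁.getD 0 2, m₂.getD 0 2, r₁.getD 0 2, r₁.getD 1 2, r₂.getD 0 2, r₂.getD 1 2]
  { code := challengePhase.compile 2 n [] [] ++ (φ.compile 2 n₁ m₁ L ++
      (challengePhase.compile 2 n₂ [] [] ++ (φ.compile 2 n₃ m₂ L ++
        extractPhase.compile 2 n₄ [] M)))
    out := (extractPhase.out 2 n₄ [] M).getD 0 2 }

/-- The inverter obtained from the attack `(A, B)`. -/
def attackInverter (q : ℕ) (A B : Machine) : Inverter :=
  -- The prover's registers are $Q,s,P,y,v$ and those of `B` are $P,y,v$; key generation leaves ten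
  -- registers in all.
  let b := compileOutput 2 owfScheme.prover [3, 4, 0, 1, 9] q B 10 [0, 1, 9]
  let n := 10 + b.1.length
  let φ := A.headD .idle
  let f := forkInverter (A.tail.headD .idle) (n + φ.code.length) (φ.regs 2 n [] ([0, 1, 9] ++ b.2))
  { code := rekeyCode ++ (b.1 ++ (φ.compile 2 n [] ([0, 1, 9] ++ b.2) ++ f.code))
    out := f.out }

/-! ### The distribution of the inverter's output. -/

section Games

variable {p : ℕ} [Fact p.Prime] {G₁ G₂ : Type*} [CommGroup G₁] [Fintype G₁] [CommGroup G₂]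
  [Fintype G₂] (D : PairingData p G₁ G₂)

def publicKey (P : G₁) (y : G₂) (Q : G₁) (s : ZMod p) : List (Val p G₁ G₂) :=
  [.el1 P, .el2 y, .el2 (D.e P Q * y ^ s.val)⁻¹]

def secretKey (Q : G₁) (s : ZMod p) : List (Val p G₁ G₂) := [.el1 Q, .sc s]

/-- Registers and first message of the impersonator. -/
def commitment (q : ℕ) (A B : Machine) (P : G₁) (y : G₂) (Q : G₁) (s : ZMod p) :
    PMF (List (Val p G₁ G₂) × List (Val p G₁ G₂)) :=
  (outputAfter D owfScheme.prover (secretKey Q s ++ publicKey D P y Q s) q B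
    (publicKey D P y Q s)).bind fun T => (A.headD .idle).run D [] (publicKey D P y Q s ++ T)

/-- A random challenge and the response of a prover with registers `σ` whose next move is `φ`. -/
def response (φ : Phase) (σ : List (Val p G₁ G₂)) : PMF ((ZMod p)ˣ × List (Val p G₁ G₂)) :=
  (PMF.uniformOfFintype (ZMod p)ˣ).bind fun (m : (ZMod p)ˣ) =>
    (φ.run D [.sc (m : ZMod p)] σ).map fun r => (m, r.2)

/-- Together with `extractElement` this forms a candidate secret key for the same $v$, read off from
two accepted conversations. -/
def extractScalar (a b : (ZMod p)ˣ × List (Val p G₁ G₂)) : ZMod p :=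
  ((a.1 : ZMod p) - b.1)⁻¹ * ((reg a.2 1).toZ - (reg b.2 1).toZ)

def extractElement (a b : (ZMod p)ˣ × List (Val p G₁ G₂)) : G₁ :=
  ((reg a.2 0).toG1 * (reg b.2 0).toG1⁻¹) ^ (((a.1 : ZMod p) - b.1)⁻¹).val

def extract (Q : G₁) (s : ZMod p) (a b : (ZMod p)ˣ × List (Val p G₁ G₂)) : G₁ :=
  (extractElement a b * Q⁻¹) ^ ((s - extractScalar a b)⁻¹).val

/-- The verifier accepts the first message `x`, the challenge `a.1` and the response `a.2`. -/
def Accepts (P : G₁) (y v : G₂) (x : List (Val p G₁ G₂)) (a : (ZMod p)ˣ × List (Val p G₁ G₂)) :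
    Prop :=
  Val.el2 (D.e P (reg a.2 0).toG1 * y ^ (reg a.2 1).toZ.val * v ^ (a.1 : ZMod p).val) = reg x 0

theorem run_challengePhase : challengePhase.run D [] [] =
    (PMF.uniformOfFintype (ZMod p)ˣ).map fun (m : (ZMod p)ˣ) =>
      ([.sc (m : ZMod p)], [.sc (m : ZMod p)]) := by
  simp [challengePhase, Phase.run, runCode, Instr.eval, Op.eval, reg,
    Function.comp_def, PMF.monad_map_eq_map, PMF.map]

theorem run_extractPhase (Q : G₁) (s : ZMod p) (a b : (ZMod p)ˣ × List (Val p G₁ G₂)) :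
    (extractPhase.run D [] [.el1 Q, .sc s, .sc (a.1 : ZMod p), .sc (b.1 : ZMod p), reg a.2 0,
      reg a.2 1, reg b.2 0, reg b.2 1]).map (fun r => (reg r.2 0).toG1) =
        PMF.pure (extract Q s a b) := by
  simp [extractPhase, Phase.run, runCode, Instr.eval, Op.eval, PMF.pure_map, reg, Val.toG1,
    Val.toZ, extract, extractElement, extractScalar, sub_eq_add_neg]

theorem run_rekeyCode (P : G₁) (y : G₂) {α : Type*} (k : List (Val p G₁ G₂) → PMF α) :
    (runCode D rekeyCode [.el1 P, .el2 y]).bind k =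
      (PMF.uniformOfFintype G₁).bind fun Q => (PMF.uniformOfFintype (ZMod p)ˣ).bind
        fun (s : (ZMod p)ˣ) =>
        k [.el1 P, .el2 y, .bit false, .el1 Q, .sc (s : ZMod p), .el2 (D.e P Q),
          .el2 (D.e P Q)⁻¹, .el2 (y ^ (s : ZMod p).val), .el2 (y ^ (s : ZMod p).val)⁻¹,
          .el2 (D.e P Q * y ^ (s : ZMod p).val)⁻¹] := by
  simp [rekeyCode, runCode, Instr.eval, Op.eval, PMF.bind_map, reg, Val.toG1,
    Val.toG2, Val.toZ, Function.comp_def, PMF.monad_map_eq_map, mul_inv, -mul_inv_rev]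

theorem run_forkInverter (φ : Phase) {σ : List (Val p G₁ G₂)} {L : List ℕ} {Q : G₁} {s : ZMod p}
    (hσ : 4 < σ.length) (hz : reg σ 2 = .bit false) (hQ : reg σ 3 = .el1 Q)
    (hs : reg σ 4 = .sc s) (hL : Bounded σ.length L) :
    (runCode D (forkInverter φ σ.length L).code σ).map
      (fun τ => (reg τ (forkInverter φ σ.length L).out).toG1) =
    (response D φ (view L σ)).bind fun a => (response D φ (view L σ)).map fun b =>
      extract Q s a b := by
  have hnil : ∀ n, Bounded n [] := fun n => by simp [Bounded]
  -- The right-hand side is written as five moves: challenge, response, challenge, response,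
  -- extraction. They are then matched with the five pieces of the program one at a time.
  have expand : ((response D φ (view L σ)).bind fun a => (response D φ (view L σ)).map fun b =>
      extract Q s a b) = (challengePhase.run D [] []).bind fun c =>
        (φ.run D c.2 (view L σ)).bind fun r => (challengePhase.run D [] []).bind fun c' =>
          (φ.run D c'.2 (view L σ)).bind fun r' =>
            (extractPhase.run D [] [.el1 Q, .sc s, reg c.2 0, reg c'.2 0, reg r.2 0,
              reg r.2 1, reg r'.2 0, reg r'.2 1]).map (fun r => (reg r.2 0).toG1) := by
    simp only [run_challengePhase, response, PMF.bind_map, PMF.map_bind, PMF.bind_bind,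
      Function.comp_def]
    refine bind_congr_support fun m _ => bind_congr_support fun r _ =>
      bind_congr_support fun m' _ => ?_
    rw [PMF.map_comp, ← PMF.bind_pure_comp]
    refine bind_congr_support fun r' _ => ?_
    exact (run_extractPhase D Q s (m, r.2) (m', r'.2)).symm
  rw [expand]
  simp only [forkInverter]
  have hc : challengePhase.code.length = 1 := rfl
  have e0 := Phase.run_compile D hz (by omega) challengePhase (hnil _) (hnil _)
  rw [show view [] σ = [] from rfl] at e0
  have b0 := challengePhase.bounded_out (z := 2) (by omega) (hnil σ.length) (hnil _)
  conv_rhs => arg 1; rw [← e0]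
  refine map_runCode_append D fun τ₁ h₁ n₁ => ?_
  dsimp only
  rw [Phase.length_compile, hc] at n₁
  rw [hc, ← n₁] at b0
  have z₁ : reg τ₁ 2 = .bit false := by rw [reg_of_prefix h₁ (by omega), hz]
  have L₁ := hL.mono (show σ.length ≤ τ₁.length by omega)
  rw [← view_of_prefix h₁ hL, ← Phase.run_compile D z₁ (by omega) φ b0 L₁, ← n₁]
  refine map_runCode_append D fun τ₂ h₂ n₂ => ?_
  dsimp only
  rw [Phase.length_compile] at n₂
  have b1 := φ.bounded_out (z := 2) (by omega) b0 L₁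
  rw [← n₂] at b1
  rw [← n₂]
  have z₂ : reg τ₂ 2 = .bit false := by rw [reg_of_prefix h₂ (by omega), z₁]
  have e2 := Phase.run_compile D z₂ (by omega) challengePhase (hnil _) (hnil _)
  rw [show view [] τ₂ = [] from rfl] at e2
  have b2 := challengePhase.bounded_out (z := 2) (by omega) (hnil τ₂.length) (hnil _)
  rw [← e2]
  refine map_runCode_append D fun τ₃ h₃ n₃ => ?_
  dsimp only
  rw [Phase.length_compile, hc] at n₃
  rw [hc, ← n₃] at b2
  have z₃ : reg τ₃ 2 = .bit false := by rw [reg_of_prefix h₃ (by omega), z₂]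
  have L₃ := L₁.mono (show τ₁.length ≤ τ₃.length by omega)
  rw [← view_of_prefix (h₂.trans h₃) L₁, ← Phase.run_compile D z₃ (by omega) φ b2 L₃, ← n₃]
  refine map_runCode_append D fun τ₄ h₄ n₄ => ?_
  dsimp only
  rw [Phase.length_compile] at n₄
  have b3 := φ.bounded_out (z := 2) (by omega) b2 L₃
  rw [← n₄] at b3
  rw [← n₄]
  have z₄ : reg τ₄ 2 = .bit false := by rw [reg_of_prefix h₄ (by omega), z₃]
  have b0' := b0.mono (show τ₁.length ≤ τ₄.length by omega)
  have b1' := b1.mono (show τ₂.length ≤ τ₄.length by omega)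
  have b2' := b2.mono (show τ₃.length ≤ τ₄.length by omega)
  rw [← view_of_prefix ((h₂.trans h₃).trans h₄) b0, ← view_of_prefix (h₃.trans h₄) b1,
    ← view_of_prefix h₄ b2, reg_view z₄, reg_view z₄, reg_view z₄, reg_view z₄, reg_view z₄,
    reg_view z₄]
  have hz' : 2 < τ₄.length := by omega
  have hσ₄ := ((h₁.trans h₂).trans h₃).trans h₄
  set M := [3, 4, (challengePhase.out 2 σ.length [] []).getD 0 2,
    (challengePhase.out 2 τ₂.length [] []).getD 0 2,
    (φ.out 2 τ₁.length (challengePhase.out 2 σ.length [] []) L).getD 0 2,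
    (φ.out 2 τ₁.length (challengePhase.out 2 σ.length [] []) L).getD 1 2,
    (φ.out 2 τ₃.length (challengePhase.out 2 τ₂.length [] []) L).getD 0 2,
    (φ.out 2 τ₃.length (challengePhase.out 2 τ₂.length [] []) L).getD 1 2] with hM
  have bM : Bounded τ₄.length M := by
    intro l hl
    simp only [hM, List.mem_cons, List.not_mem_nil, or_false] at hl
    rcases hl with rfl | rfl | rfl | rfl | rfl | rfl | rfl | rfl
    · omega
    · omega
    all_goals apply Bounded.getD <;> assumption
  have e5 := Phase.run_compile D z₄ hz' extractPhase (hnil _) bM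
  rw [show view [] τ₄ = [] from rfl] at e5
  have hv : view M τ₄ = [.el1 Q, .sc s,
    reg τ₄ ((challengePhase.out 2 σ.length [] []).getD 0 2),
    reg τ₄ ((challengePhase.out 2 τ₂.length [] []).getD 0 2),
    reg τ₄ ((φ.out 2 τ₁.length (challengePhase.out 2 σ.length [] []) L).getD 0 2),
    reg τ₄ ((φ.out 2 τ₁.length (challengePhase.out 2 σ.length [] []) L).getD 1 2),
    reg τ₄ ((φ.out 2 τ₃.length (challengePhase.out 2 τ₂.length [] []) L).getD 0 2),
    reg τ₄ ((φ.out 2 τ₃.length (challengePhase.out 2 τ₂.length [] []) L).getD 1 2)] := by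
    rw [← hQ, ← hs, ← reg_of_prefix hσ₄ (by omega), ← reg_of_prefix hσ₄ (by omega)]
    rfl
  rw [← hv, ← e5, PMF.map_comp]
  refine map_congr_support fun τ hτ => ?_
  obtain ⟨h, -⟩ := prefix_of_mem_support_runCode D hτ
  simp only [Function.comp]
  rw [reg_view (by rw [reg_of_prefix h hz', z₄])]

theorem run_attackInverter (q : ℕ) (A B : Machine) (P : G₁) (y : G₂) :
    (runCode D (attackInverter q A B).code [.el1 P, .el2 y]).map
      (fun τ => (reg τ (attackInverter q A B).out).toG1) =
    (PMF.uniformOfFintype G₁).bind fun Q => (PMF.uniformOfFintype (ZMod p)ˣ).bind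
        fun (s : (ZMod p)ˣ) =>
      (commitment D q A B P y Q (s : ZMod p)).bind fun c =>
        (response D (A.tail.headD .idle) c.1).bind fun a =>
          (response D (A.tail.headD .idle) c.1).map fun b => extract Q (s : ZMod p) a b := by
  simp only [attackInverter]
  rw [runCode_append, PMF.map_bind, run_rekeyCode]
  refine bind_congr_support fun Q _ => bind_congr_support fun s _ => ?_
  set σ : List (Val p G₁ G₂) := [.el1 P, .el2 y, .bit false, .el1 Q, .sc (s : ZMod p),
    .el2 (D.e P Q), .el2 (D.e P Q)⁻¹, .el2 (y ^ (s : ZMod p).val), .el2 (y ^ (s : ZMod p).val)⁻¹,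
    .el2 (D.e P Q * y ^ (s : ZMod p).val)⁻¹] with hσ
  have hlen : σ.length = 10 := rfl
  have hz : reg σ 2 = .bit false := rfl
  have hS : Bounded σ.length [3, 4, 0, 1, 9] := by
    intro l hl
    simp at hl
    omega
  have hL : Bounded σ.length [0, 1, 9] := by
    intro l hl
    simp at hl
    omega
  have e1 := run_compileOutput D hz (by omega) owfScheme.prover q B hS hL
  have b1 := bounded_compileOutput (z := 2) (n := σ.length) (by omega) owfScheme.prover q B hS hL
  rw [show view [3, 4, 0, 1, 9] σ = secretKey Q (s : ZMod p) ++ publicKey D P y Q s from rfl,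
    show view [0, 1, 9] σ = publicKey D P y Q s from rfl] at e1
  rw [commitment, ← e1, PMF.bind_bind, ← hlen]
  refine map_runCode_append D fun τ h n => ?_
  rw [← n] at b1
  have z₁ : reg τ 2 = .bit false := by rw [reg_of_prefix h (by omega), hz]
  have hL₁ := (hL.mono (show σ.length ≤ τ.length by omega)).append b1
  rw [show publicKey D P y Q s = view [0, 1, 9] σ from rfl, ← view_of_prefix h hL, ← view_append]
  have e2 := Phase.run_compile D z₁ (by omega) (A.headD .idle) (M := []) (by simp [Bounded]) hL₁
  rw [show view [] τ = [] from rfl] at e2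
  rw [← e2, ← n]
  refine map_runCode_append D fun ρ h' n' => ?_
  rw [Phase.length_compile] at n'
  have b2 := (A.headD .idle).bounded_regs (z := 2) (by omega) (M := [])
    (by simp [Bounded]) hL₁
  rw [← n'] at b2
  rw [← n']
  have hρ := h.trans h'
  exact run_forkInverter D _ (by omega) (by rw [reg_of_prefix hρ (by omega), hz])
    (by rw [reg_of_prefix hρ (by omega)]; rfl) (by rw [reg_of_prefix hρ (by omega)]; rfl) b2

end Games

/-! ### Running times. -/

theorem prover_time_le {p : ℕ} {G₁ G₂ : Type*} (D : PairingData p G₁ G₂) :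
    owfScheme.prover.time D.cost ≤ D.opTime := by
  simp [owfScheme, Machine.time, codeTime, Instr.time, PairingData.opTime]
  omega

theorem verifier_time_le {p : ℕ} {G₁ G₂ : Type*} (D : PairingData p G₁ G₂) :
    owfScheme.verifier.time D.cost ≤ 2 * D.opTime := by
  simp [owfScheme, Machine.time, codeTime, Instr.time, PairingData.opTime]
  omega

/-- Only the second move of `A` runs twice. Key generation, two challenges and extraction cost at
most $2+2+3=7$ units `opTime`. -/
theorem codeTime_attackInverter (q : ℕ) (A B : Machine) {p : ℕ} {G₁ G₂ : Type*}
    (D : PairingData p G₁ G₂) :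
    codeTime D.cost (attackInverter q A B).code ≤
      2 * (A.time D.cost + B.time D.cost + D.opTime * q) + 2 * (4 * D.opTime) := by
  have h1 := codeTime_compileOutput D.cost 2 owfScheme.prover [3, 4, 0, 1, 9] q B 10 [0, 1, 9]
  have h2 : owfScheme.prover.time D.cost * q ≤ D.opTime * q := by
    gcongr
    exact prover_time_le D
  have h3 := Machine.time_headD_tail D.cost A
  have h4 := Machine.time_headD_tail D.cost A.tail
  have h5 : codeTime D.cost rekeyCode ≤ 2 * D.opTime := by
    simp [rekeyCode, codeTime, Instr.time, PairingData.opTime]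
    omega
  have h6 : codeTime D.cost extractPhase.code ≤ 3 * D.opTime := by
    simp [extractPhase, codeTime, Instr.time, PairingData.opTime]
    omega
  have h7 : codeTime D.cost challengePhase.code ≤ D.opTime := by
    simp [challengePhase, codeTime, Instr.time, PairingData.opTime]
    omega
  simp only [attackInverter, forkInverter, codeTime_append, Phase.codeTime_compile]
  omega

/-! ### Security and viability of the protocol -/

section Protocol

/-- Division of the verification equations gives $e(P,T/T')y^{a-a'}=(e(P,Q)y^s)^{m-m'}$. Taking the
root of order $m-m'$ and comparing with the known key yields $e(P,E/Q)=y^{s-\sigma}$. -/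
theorem e_extract {p : ℕ} [Fact p.Prime] {G₁ G₂ : Type*} [CommGroup G₁] [CommGroup G₂]
    [IsCyclic G₁] [IsCyclic G₂] {D : PairingData p G₁ G₂} (hD : D.IsCryptographicPairing)
    {P Q : G₁} {s : ZMod p} {y : G₂} {x : List (Val p G₁ G₂)} {a b : (ZMod p)ˣ × List (Val p G₁ G₂)}
    (ha : Accepts D P y (D.e P Q * y ^ s.val)⁻¹ x a)
    (hb : Accepts D P y (D.e P Q * y ^ s.val)⁻¹ x b) (hab : a.1 ≠ b.1)
    (hs : s ≠ extractScalar a b) : D.e P (extract Q s a b) = y := by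
  obtain ⟨log, hlog, hmul, hinv, hpow⟩ := exists_log hD.card_right
  have h := congrArg log (Val.el2.inj (ha.trans hb.symm))
  have hd : (a.1 : ZMod p) - b.1 ≠ 0 := sub_ne_zero.2 fun h => hab (Units.ext h)
  have hc := sub_ne_zero.2 hs
  apply hlog
  simp only [hmul, hpow, hinv] at h
  simp only [extract, extractElement, hD.e_pow, hD.e_mul, hD.e_inv, hmul, hpow, hinv]
  rw [inv_mul_eq_iff_eq_mul₀ hc, extractScalar]
  apply mul_left_cancel₀ hd
  have hdi := mul_inv_cancel₀ hd
  set d := (a.1 : ZMod p) - b.1 with hdd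
  linear_combination h + hdi * (log (D.e P (reg a.2 0).toG1) - log (D.e P (reg b.2 0).toG1) +
    ((reg a.2 1).toZ - (reg b.2 1).toZ) * log y) - (log (D.e P Q) + s * log y) * hdd

variable {p : ℕ} [Fact p.Prime] {G₁ G₂ : Type*} [CommGroup G₁] [Fintype G₁] [CommGroup G₂]
  [Fintype G₂] (D : PairingData p G₁ G₂)

theorem keys_bind {β : Type*} (α : List Bool)
    (k : List (Val p G₁ G₂) × List (Val p G₁ G₂) → PMF β) :
    ((owfScheme.gen α).keys D).bind k =
      (PMF.uniformOfFintype G₁).bind fun P => (PMF.uniformOfFintype G₂).bind fun y =>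
        (PMF.uniformOfFintype G₁).bind fun Q => (PMF.uniformOfFintype (ZMod p)ˣ).bind
        fun (s : (ZMod p)ˣ) =>
          k (secretKey Q (s : ZMod p), publicKey D P y Q s) := by
  -- Key generation samples `Q` before `y`; the swap puts first the pair $(P,y)$ that the inverter
  -- receives as input.
  refine Eq.trans ?_ (bind_congr_support fun P _ => PMF.bind_comm _ _ _)
  simp [KeyGen.keys, owfScheme, runCode, Instr.eval, Op.eval, PMF.bind_map, reg, Val.toG1,
    Val.toG2, Val.toZ, Function.comp_def, PMF.monad_map_eq_map, mul_inv, -mul_inv_rev,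
    secretKey, publicKey]

theorem run_verifier_head (P : G₁) (y v : G₂) (msg : List (Val p G₁ G₂)) :
    (owfScheme.verifier.headD .idle).run D msg [.el1 P, .el2 y, .el2 v] =
      (PMF.uniformOfFintype (ZMod p)ˣ).map fun (m : (ZMod p)ˣ) =>
        ([.el1 P, .el2 y, .el2 v, reg msg 0, .sc (m : ZMod p)], [.sc (m : ZMod p)]) := by
  simp [owfScheme, Phase.run, runCode, Instr.eval, Op.eval, reg,
    Function.comp_def, PMF.monad_map_eq_map, PMF.map]

open Classical in
theorem run_verifier_last (P : G₁) (y v : G₂) (x : List (Val p G₁ G₂))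
    (a : (ZMod p)ˣ × List (Val p G₁ G₂)) :
    ((owfScheme.verifier.tail.headD .idle).run D a.2
      [.el1 P, .el2 y, .el2 v, reg x 0, .sc (a.1 : ZMod p)]).map (fun b => (reg b.2 0).toBit) =
      PMF.pure (decide (Accepts D P y v x a)) := by
  simp [owfScheme, Phase.run, runCode, Instr.eval, Op.eval, reg, Val.toG1, Val.toG2, Val.toZ,
    Val.toBit, PMF.pure_map, Accepts, List.range_succ]

open Classical in
theorem verdict_verifier (A : Machine) (P : G₁) (y v : G₂) (σ : List (Val p G₁ G₂)) :
    verdict D A owfScheme.verifier σ [.el1 P, .el2 y, .el2 v] =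
      ((A.headD .idle).run D [] σ).bind fun c =>
        (response D (A.tail.headD .idle) c.1).map fun a => decide (Accepts D P y v c.2 a) := by
  rw [verdict, show owfScheme.verifier.length = 2 from rfl, interact, PMF.map_bind]
  refine bind_congr_support fun c _ => ?_
  rw [run_verifier_head, PMF.bind_map, PMF.map_bind, response, PMF.map_bind]
  refine bind_congr_support fun m _ => ?_
  simp only [Function.comp_def, interact, PMF.map_bind, PMF.pure_map]
  rw [PMF.map_comp, ← PMF.bind_pure_comp]
  refine bind_congr_support fun r _ => ?_
  exact run_verifier_last D P y v c.2 (m, r.2)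

theorem run_prover_head (Q P : G₁) (s : ZMod p) (y v : G₂) :
    (owfScheme.prover.headD .idle).run D [] [.el1 Q, .sc s, .el1 P, .el2 y, .el2 v] =
      (PMF.uniformOfFintype (G₁ × ZMod p)).map fun a =>
        ([.el1 Q, .sc s, .el1 P, .el2 y, .el2 v, .el1 a.1, .sc a.2, .el2 (D.e P a.1),
          .el2 (y ^ a.2.val), .el2 (D.e P a.1 * y ^ a.2.val)],
          [.el2 (D.e P a.1 * y ^ a.2.val)]) := by
  rw [uniform_prod]
  simp [owfScheme, Phase.run, runCode, Instr.eval, Op.eval, reg, Val.toG1, Val.toG2, Val.toZ,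
    Function.comp_def, PMF.map]

/-- The hypothesis `hk` discards the prover's final registers, which contain its secrets; only the
message matters afterwards. -/
theorem run_prover_last (Q P R : G₁) (s r : ZMod p) (y v : G₂) (u u' u'' : Val p G₁ G₂)
    (msg : List (Val p G₁ G₂)) {β : Type*}
    (k : List (Val p G₁ G₂) × List (Val p G₁ G₂) → PMF β) (k' : List (Val p G₁ G₂) → PMF β)
    (hk : ∀ b, k b = k' b.2) :
    ((owfScheme.prover.tail.headD .idle).run D msg
      [.el1 Q, .sc s, .el1 P, .el2 y, .el2 v, .el1 R, .sc r, u, u', u'']).bind k =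
      k' [.el1 (R * Q ^ (reg msg 0).toZ.val), .sc (r + (reg msg 0).toZ * s)] := by
  simp [owfScheme, Phase.run, runCode, Instr.eval, Op.eval, reg, Val.toG1, Val.toZ,
    PMF.pure_map, hk]

theorem interact_prover (Q P : G₁) (s : ZMod p) (y v : G₂) (B : Machine)
    (τ : List (Val p G₁ G₂)) :
    (interact D owfScheme.prover.length owfScheme.prover B []
      [.el1 Q, .sc s, .el1 P, .el2 y, .el2 v] τ).map (fun r => r.2.1) =
    (PMF.uniformOfFintype (G₁ × ZMod p)).bind fun a =>
      ((B.headD .idle).run D [.el2 (D.e P a.1 * y ^ a.2.val)] τ).bind fun b =>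
        ((B.tail.headD .idle).run D [.el1 (a.1 * Q ^ (reg b.2 0).toZ.val),
          .sc (a.2 + (reg b.2 0).toZ * s)] b.1).map Prod.fst := by
  rw [show owfScheme.prover.length = 2 from rfl, interact, PMF.map_bind, run_prover_head,
    PMF.bind_map]
  refine bind_congr_support fun a _ => ?_
  simp only [Function.comp_def, interact, PMF.map_bind, PMF.pure_map]
  refine bind_congr_support fun b _ => ?_
  exact run_prover_last D Q P a.1 s a.2 y v _ _ _ b.2 _
    (fun m => ((B.tail.headD .idle).run D m b.1).bind fun c => PMF.pure c.1) fun _ => rfl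

variable [IsCyclic G₁] [IsCyclic G₂] {D}

/-- The interaction with the honest prover does not depend on which of the secret keys for the
given public key the prover uses. -/
theorem outputAfter_congr (hD : D.IsCryptographicPairing) {P Q Q' : G₁} {s s' : ZMod p} {y : G₂}
    (h : D.e P Q * y ^ s.val = D.e P Q' * y ^ s'.val) (v : G₂) (q : ℕ) (B : Machine)
    (τ : List (Val p G₁ G₂)) :
    outputAfter D owfScheme.prover [.el1 Q, .sc s, .el1 P, .el2 y, .el2 v] q B τ =
      outputAfter D owfScheme.prover [.el1 Q', .sc s', .el1 P, .el2 y, .el2 v] q B τ := by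
  obtain ⟨log, hlog, hmul, hinv, hpow⟩ := exists_log hD.card_right
  have h' := congrArg log h
  simp only [hmul, hpow] at h'
  have round : ∀ (B : Machine) (τ : List (Val p G₁ G₂)),
      (interact D owfScheme.prover.length owfScheme.prover B []
        [.el1 Q, .sc s, .el1 P, .el2 y, .el2 v] τ).map (fun r => r.2.1) =
      (interact D owfScheme.prover.length owfScheme.prover B []
        [.el1 Q', .sc s', .el1 P, .el2 y, .el2 v] τ).map (fun r => r.2.1) := fun B τ => by
    rw [interact_prover, interact_prover]
    refine uniform_bind_reindex (fun a : G₁ × ZMod p => D.e P a.1 * y ^ a.2.val)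
      (fun x => (B.headD .idle).run D [.el2 x] τ) _ _
      -- The shift of $(R,r)$ by $((Q/Q')^m,\,m(s-s'))$, where $m$ is whatever `B` sent. It fixes
      -- $x$ because both keys give the same $v$, and $R(Q/Q')^mQ'^m=RQ^m$.
      (fun b => Equiv.prodCongr
        (Equiv.mulRight (Q ^ (reg b.2 0).toZ.val * (Q' ^ (reg b.2 0).toZ.val)⁻¹))
        (Equiv.addRight ((reg b.2 0).toZ * s - (reg b.2 0).toZ * s'))) ?_ ?_
    · intro b a
      apply hlog
      simp only [Equiv.prodCongr_apply, Prod.map, Equiv.coe_mulRight, Equiv.coe_addRight,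
        hD.e_mul, hD.e_inv, hD.e_pow, hmul, hinv, hpow]
      linear_combination (reg b.2 0).toZ * h'
    · intro b a
      simp only [Equiv.prodCongr_apply, Prod.map, Equiv.coe_mulRight, Equiv.coe_addRight]
      rw [mul_assoc, inv_mul_cancel_right]
      congr 5
      ring
  induction q generalizing B τ with
  | zero => rfl
  | succ q ih =>
    have e : ∀ σ : List (Val p G₁ G₂), outputAfter D owfScheme.prover σ (q + 1) B τ =
        ((interact D owfScheme.prover.length owfScheme.prover B [] σ τ).map
          fun r => r.2.1).bind (outputAfter D owfScheme.prover σ q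
            (B.drop owfScheme.prover.length)) := fun σ => by
      rw [outputAfter, PMF.bind_map]
      rfl
    rw [e, e, round]
    exact bind_congr_support fun τ' _ => ih _ _

theorem commitment_congr (hD : D.IsCryptographicPairing) {P Q Q' : G₁} {s s' : ZMod p} {y : G₂}
    (h : D.e P Q * y ^ s.val = D.e P Q' * y ^ s'.val) (q : ℕ) (A B : Machine) :
    commitment D q A B P y Q s = commitment D q A B P y Q' s' := by
  have hk : publicKey D P y Q s = publicKey D P y Q' s' := by rw [publicKey, publicKey, h]
  rw [commitment, commitment, hk]
  congr 1
  exact outputAfter_congr hD h _ q B _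

theorem owfScheme_isViable (hD : D.IsCryptographicPairing) : owfScheme.IsViable D := by
  classical
  intro α
  obtain ⟨log, hlog, hmul, hinv, hpow⟩ := exists_log hD.card_right
  have key : ((owfScheme.gen α).keys D).bind (fun k =>
      verdict D owfScheme.prover owfScheme.verifier (k.1 ++ k.2) k.2) = PMF.pure true := by
    rw [keys_bind]
    refine Eq.trans (bind_congr_support fun P _ => bind_congr_support fun y _ =>
      bind_congr_support fun Q _ => bind_congr_support (g := fun _ => PMF.pure true)
      fun s _ => ?_) (by simp)
    rw [publicKey, verdict_verifier]
    refine Eq.trans (congrArg₂ _ (run_prover_head D Q P (s : ZMod p) y _) rfl) ?_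
    rw [PMF.bind_map]
    refine (bind_congr_support (g := fun _ => PMF.pure true) fun a _ => ?_).trans (by simp)
    simp only [Function.comp_def, response, PMF.map_bind]
    refine (bind_congr_support (g := fun _ => PMF.pure true) fun m _ => ?_).trans (by simp)
    rw [PMF.map_comp, ← PMF.bind_pure_comp]
    refine (run_prover_last D Q P a.1 (s : ZMod p) a.2 y _ _ _ _ [.sc (m : ZMod p)] _
      (fun r => PMF.pure (decide (Accepts D P y (D.e P Q * y ^ (s : ZMod p).val)⁻¹
        [.el2 (D.e P a.1 * y ^ a.2.val)] (m, r)))) fun _ => rfl).trans ?_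
    congr 1
    rw [decide_eq_true_eq]
    have : D.e P (a.1 * Q ^ (m : ZMod p).val) * y ^ (a.2 + (m : ZMod p) * s).val *
        (D.e P Q * y ^ (s : ZMod p).val)⁻¹ ^ (m : ZMod p).val = D.e P a.1 * y ^ a.2.val := by
      apply hlog
      simp only [hD.e_mul, hD.e_pow, hmul, hinv, hpow]
      ring
    simpa [Accepts, reg, Val.toG1, Val.toZ] using this
  rw [IdScheme.honestProb, key]
  simp

end Protocol

/-! ### Rewinding the impersonator -/

/-- A key pair, registers of the impersonator and its first message. -/
structure Commitment (p : ℕ) (G₁ G₂ : Type*) where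
  P : G₁
  y : G₂
  Q : G₁
  s : (ZMod p)ˣ
  state : List (Val p G₁ G₂)
  msg : List (Val p G₁ G₂)

section Forking

variable {p : ℕ} [Fact p.Prime] {G₁ G₂ : Type*} [CommGroup G₁] [Fintype G₁] [CommGroup G₂]
  [Fintype G₂] (D : PairingData p G₁ G₂)

/-- The attack up to the first message of the impersonator. -/
def commitGame (q : ℕ) (A B : Machine) : PMF (Commitment p G₁ G₂) :=
  (PMF.uniformOfFintype G₁).bind fun P => (PMF.uniformOfFintype G₂).bind fun y =>
    (PMF.uniformOfFintype G₁).bind fun Q => (PMF.uniformOfFintype (ZMod p)ˣ).bind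
      fun (s : (ZMod p)ˣ) => (commitment D q A B P y Q (s : ZMod p)).map fun c =>
        ⟨P, y, Q, s, c.1, c.2⟩

abbrev Conversation (p : ℕ) (G₁ G₂ : Type*) : Type _ := (ZMod p)ˣ × List (Val p G₁ G₂)

def Commitment.Accepts (c : Commitment p G₁ G₂) (a : Conversation p G₁ G₂) : Prop :=
  PairingId.Accepts D c.P c.y (D.e c.P c.Q * c.y ^ (c.s : ZMod p).val)⁻¹ c.msg a

/-- The attack with the impersonator rewound to obtain a second conversation. -/
def forkGame (q : ℕ) (A B : Machine) :
    PMF (Commitment p G₁ G₂ × Conversation p G₁ G₂ × Conversation p G₁ G₂) :=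
  (commitGame D q A B).bind fun c => (response D (A.tail.headD .idle) c.state).bind fun a =>
    (response D (A.tail.headD .idle) c.state).map fun b => (c, a, b)

theorem attackProb_eq (q : ℕ) (α : List Bool) (A B : Machine) :
    owfScheme.attackProb D q α A B = (∑' c, commitGame D q A B c *
      prob (response D (A.tail.headD .idle) c.state) (c.Accepts D)).toReal := by
  classical
  rw [IdScheme.attackProb]
  congr 1
  have h : (((owfScheme.gen α).keys D).bind fun k =>
      (outputAfter D owfScheme.prover (k.1 ++ k.2) q B k.2).bind fun T =>
        verdict D A owfScheme.verifier (k.2 ++ T) k.2) =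
      (commitGame D q A B).bind fun c =>
        (response D (A.tail.headD .idle) c.state).map fun a => decide (c.Accepts D a) := by
    rw [keys_bind]
    simp only [commitGame, PMF.bind_bind, PMF.bind_map, Function.comp_def, commitment]
    refine bind_congr_support fun P _ => bind_congr_support fun y _ =>
      bind_congr_support fun Q _ => bind_congr_support fun s _ => bind_congr_support fun T _ => ?_
    rw [publicKey, verdict_verifier]
    rfl
  rw [h, ← PMF.toOuterMeasure_apply_singleton]
  refine (prob_bind _ _ (· = true)).trans (tsum_congr fun c => ?_)
  rw [prob_map]
  simp only [decide_eq_true_eq]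

/-- Given the commitment, the two conversations are independent and identically distributed, so both
are accepted with the square of the conditional probability; Jensen's inequality averages this. -/
theorem sq_attack_le_fork (q : ℕ) (A B : Machine) :
    (∑' c, commitGame D q A B c *
      prob (response D (A.tail.headD .idle) c.state) (c.Accepts D)) ^ 2 ≤
    prob (forkGame D q A B) (fun f => f.1.Accepts D f.2.1 ∧ f.1.Accepts D f.2.2) := by
  refine (sq_tsum_mul_le _ _ fun c => prob_le_one _ _).trans_eq ?_
  rw [forkGame, prob_bind]
  refine tsum_congr fun c => ?_
  exact congrArg _ (prob_bind_map_and (response D (A.tail.headD .idle) c.state)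
    (fun c : Commitment p G₁ G₂ => c.Accepts D) c).symm

theorem successProb_attackInverter (q : ℕ) (A B : Machine) :
    (attackInverter q A B).successProb D = (prob (forkGame D q A B) fun f =>
      D.e f.1.P (extract f.1.Q (f.1.s : ZMod p) f.2.1 f.2.2) = f.1.y).toReal := by
  rw [Inverter.successProb, prob_eq_map, uniform_prod]
  congr 2
  simp only [forkGame, commitGame, PMF.bind_bind, PMF.bind_map, PMF.map_bind, PMF.map_comp,
    Function.comp_def]
  refine bind_congr_support fun P _ => bind_congr_support fun y _ => ?_
  have := congrArg (PMF.map fun h => D.e P h = y) (run_attackInverter D q A B P y)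
  simpa only [PMF.map_bind, PMF.map_comp, Function.comp_def] using this

theorem response_map_fst (φ : Phase) (σ : List (Val p G₁ G₂)) :
    (response D φ σ).map Prod.fst = PMF.uniformOfFintype (ZMod p)ˣ := by
  simp [response, PMF.map_bind, PMF.map_comp, Function.comp_def, map_fun_const]

theorem prob_challenge_eq (q : ℕ) (A B : Machine) :
    prob (forkGame D q A B) (fun f => f.2.1.1 = f.2.2.1) ≤ ((p - 1 : ℕ) : ℝ≥0∞)⁻¹ := by
  refine prob_bind_le _ _ _ fun c => prob_bind_le _ _ _ fun a => ?_
  rw [prob_map, ← ZMod.card_units p, ← prob_uniform_eq a.1, ← response_map_fst D _ c.state,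
    prob_map]
  exact prob_mono _ fun b h => h.symm

variable {D}

theorem prob_base_eq_one (hD : D.IsCryptographicPairing) (q : ℕ) (A B : Machine) :
    prob (forkGame D q A B) (fun f => f.1.P = 1) ≤ (p : ℝ≥0∞)⁻¹ := by
  have h : (forkGame D q A B).map (fun f => f.1.P) = PMF.uniformOfFintype G₁ := by
    simp [forkGame, commitGame, PMF.map_bind, PMF.map_comp, Function.comp_def, map_fun_const,
      PMF.bind_bind, PMF.bind_map]
  have := prob_map (forkGame D q A B) (fun f => f.1.P) (fun P => P = 1)
  rw [← this, h, prob_uniform_eq, ← Nat.card_eq_fintype_card, hD.card_left]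

/-- For $P\ne1$, a change of variables in $Q$ makes $s$ independent of everything the impersonator
sees, hence of the extracted scalar; $s$ is uniform on $p-1$ values. -/
theorem prob_scalar_eq [IsCyclic G₁] [IsCyclic G₂] (hD : D.IsCryptographicPairing) (q : ℕ)
    (A B : Machine) :
    prob (forkGame D q A B)
      (fun f => f.1.P ≠ 1 ∧ (f.1.s : ZMod p) = extractScalar f.2.1 f.2.2) ≤
      ((p - 1 : ℕ) : ℝ≥0∞)⁻¹ := by
  let κ (P : G₁) (y : G₂) (Q : G₁) (s : ZMod p) : PMF (ZMod p) :=
    (commitment D q A B P y Q s).bind fun c =>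
      (response D (A.tail.headD .idle) c.1).bind fun a =>
        (response D (A.tail.headD .idle) c.1).map fun b => extractScalar a b
  have h : (forkGame D q A B).map
      (fun f => (f.1.P, (f.1.s : ZMod p), extractScalar f.2.1 f.2.2)) =
      (PMF.uniformOfFintype G₁).bind fun P => (PMF.uniformOfFintype G₂).bind fun y =>
        (PMF.uniformOfFintype G₁).bind fun Q => (PMF.uniformOfFintype (ZMod p)ˣ).bind
          fun (s : (ZMod p)ˣ) => (κ P y Q s).map fun s' => (P, (s : ZMod p), s') := by
    simp [κ, forkGame, commitGame, PMF.map_bind, PMF.map_comp, Function.comp_def,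
      PMF.bind_bind, PMF.bind_map]
  rw [← prob_map _ (fun f : Commitment p G₁ G₂ × Conversation p G₁ G₂ × Conversation p G₁ G₂ =>
    (f.1.P, (f.1.s : ZMod p), extractScalar f.2.1 f.2.2)) (fun t => t.1 ≠ 1 ∧ t.2.1 = t.2.2), h]
  refine prob_bind_le _ _ _ fun P => prob_bind_le _ _ _ fun y => ?_
  by_cases hP : P = 1
  · refine prob_bind_le _ _ _ fun Q => prob_bind_le _ _ _ fun s => ?_
    rw [prob_map]
    refine (prob_mono _ (F := fun _ => False) fun t ht => ht.1 hP).trans ?_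
    simp [prob]
  obtain ⟨Y, hY⟩ := hD.e_surjective hP y
  -- With $e(P,Y)=y$, the keys $(QY^{-s},s)$ and $(Q,0)$ have the same $v$. The element $Y$ occurs
  -- only in the analysis and is never computed.
  have hκ : ∀ Q (s : ZMod p), κ P y (Q * (Y ^ s.val)⁻¹) s = κ P y Q 0 := fun Q s => by
    simp only [κ]
    rw [commitment_congr hD]
    rw [hD.e_mul, hD.e_inv, hD.e_pow, hY]
    simp
  rw [PMF.bind_comm]
  have : ((PMF.uniformOfFintype (ZMod p)ˣ).bind fun (s : (ZMod p)ˣ) =>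
      (PMF.uniformOfFintype G₁).bind fun Q =>
        (κ P y Q s).map fun s' => (P, (s : ZMod p), s')) =
      (PMF.uniformOfFintype G₁).bind fun Q => (κ P y Q 0).bind fun s' =>
        (PMF.uniformOfFintype (ZMod p)ˣ).map fun (s : (ZMod p)ˣ) => (P, (s : ZMod p), s') := by
    refine Eq.trans (bind_congr_support fun s _ => ?_) (PMF.bind_comm _ _ _ |>.trans
      (bind_congr_support fun Q _ => PMF.bind_comm _ (κ P y Q 0)
        fun (s : (ZMod p)ˣ) s' => PMF.pure (P, (s : ZMod p), s')))
    rw [← uniform_bind_equiv (Equiv.mulRight (Y ^ (s : ZMod p).val)⁻¹)]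
    refine bind_congr_support fun Q _ => ?_
    rw [Equiv.coe_mulRight, hκ]
    rfl
  rw [this]
  refine prob_bind_le _ _ _ fun Q => prob_bind_le _ _ _ fun s' => ?_
  rw [prob_map]
  -- The extracted scalar may be $0$, which is no unit and is never hit.
  by_cases hs : ∃ u : (ZMod p)ˣ, (u : ZMod p) = s'
  · obtain ⟨u, rfl⟩ := hs
    rw [← ZMod.card_units p, ← prob_uniform_eq u]
    exact prob_mono _ fun s h => Units.ext h.2
  · refine (prob_mono _ (F := fun _ => False) fun s h => hs ⟨s, h.2⟩).trans ?_
    simp [prob]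

theorem sq_attack_le [IsCyclic G₁] [IsCyclic G₂] (hD : D.IsCryptographicPairing) (q : ℕ)
    (α : List Bool) (A B : Machine) :
    owfScheme.attackProb D q α A B ^ 2 ≤
      (attackInverter q A B).successProb D + 1 / p + 2 / (p - 1) := by
  have hp := (Fact.out : p.Prime).two_le
  have h : prob (forkGame D q A B) (fun f => f.1.Accepts D f.2.1 ∧ f.1.Accepts D f.2.2) ≤
      prob (forkGame D q A B) (fun f =>
        D.e f.1.P (extract f.1.Q (f.1.s : ZMod p) f.2.1 f.2.2) = f.1.y) +
      ((p : ℝ≥0∞)⁻¹ + (((p - 1 : ℕ) : ℝ≥0∞)⁻¹ + ((p - 1 : ℕ) : ℝ≥0∞)⁻¹)) := by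
    refine (prob_mono _ (F := fun f =>
      D.e f.1.P (extract f.1.Q (f.1.s : ZMod p) f.2.1 f.2.2) = f.1.y ∨ (f.1.P = 1 ∨
        (f.2.1.1 = f.2.2.1 ∨
          (f.1.P ≠ 1 ∧ (f.1.s : ZMod p) = extractScalar f.2.1 f.2.2)))) ?_).trans ?_
    · rintro f ⟨ha, hb⟩
      by_cases h1 : f.1.P = 1
      · exact .inr (.inl h1)
      by_cases h2 : f.2.1.1 = f.2.2.1
      · exact .inr (.inr (.inl h2))
      by_cases h3 : (f.1.s : ZMod p) = extractScalar f.2.1 f.2.2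
      · exact .inr (.inr (.inr ⟨h1, h3⟩))
      · exact .inl (e_extract hD ha hb h2 h3)
    · refine (prob_or_le _ _ _).trans (add_le_add le_rfl ((prob_or_le _ _ _).trans
        (add_le_add (prob_base_eq_one hD q A B) ((prob_or_le _ _ _).trans
          (add_le_add (prob_challenge_eq D q A B) (prob_scalar_eq hD q A B))))))
  have hu : ((p - 1 : ℕ) : ℝ≥0∞)⁻¹ ≠ ⊤ := ENNReal.inv_ne_top.2 (by
    rw [Nat.cast_ne_zero]
    omega)
  have hv : (p : ℝ≥0∞)⁻¹ ≠ ⊤ := ENNReal.inv_ne_top.2 (by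
    rw [Nat.cast_ne_zero]
    omega)
  have hw : ∀ E, prob (forkGame D q A B) E ≠ ⊤ := fun E =>
    ne_top_of_le_ne_top ENNReal.one_ne_top (prob_le_one _ E)
  have huu := ENNReal.add_ne_top.2 ⟨hu, hu⟩
  have hvu := ENNReal.add_ne_top.2 ⟨hv, huu⟩
  have := ENNReal.toReal_mono (ENNReal.add_ne_top.2 ⟨hw _, hvu⟩)
    ((sq_attack_le_fork D q A B).trans h)
  rw [ENNReal.toReal_pow, ← attackProb_eq D q α, ENNReal.toReal_add (hw _) hvu,
    ENNReal.toReal_add hv huu, ENNReal.toReal_add hu hu,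
    ← successProb_attackInverter] at this
  simp only [ENNReal.toReal_inv, ENNReal.toReal_natCast,
    Nat.cast_sub (show 1 ≤ p by omega), Nat.cast_one] at this
  refine this.trans_eq ?_
  ring

/-- The algorithm that outputs a random element. -/
def guess : Inverter := ⟨[.op .sample1 0 0], 2⟩

/-- The target $x$ is uniform and independent of $e(g,r)$ for the guess $r$; this holds even for
$g=1$. -/
theorem successProb_guess (hD : D.IsCryptographicPairing) :
    guess.successProb D = 1 / p := by
  rw [Inverter.successProb, uniform_prod]
  have h : ((PMF.uniformOfFintype G₁).bind fun a =>
      (PMF.uniformOfFintype G₂).map fun b => (a, b)).bind (fun gx : G₁ × G₂ =>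
        (runCode D guess.code [.el1 gx.1, .el2 gx.2]).map
          fun σ => D.e gx.1 (reg σ guess.out).toG1 = gx.2) =
      (PMF.uniformOfFintype G₁).bind fun g => (PMF.uniformOfFintype G₁).bind fun r =>
        (PMF.uniformOfFintype G₂).map fun x => x = D.e g r := by
    rw [PMF.bind_bind]
    refine bind_congr_support fun g _ => ?_
    refine Eq.trans ?_ (PMF.bind_comm _ _ fun x r => PMF.pure (x = D.e g r))
    rw [PMF.bind_map]
    refine bind_congr_support fun x _ => ?_
    simp [guess, runCode, Instr.eval, Op.eval, PMF.bind_map, PMF.map_bind, PMF.pure_map, reg,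
      Val.toG1, Function.comp_def, eq_comm]
  rw [h]
  have := prob_bind_eq_const (PMF.uniformOfFintype G₁) (fun g =>
    (PMF.uniformOfFintype G₁).bind fun r => (PMF.uniformOfFintype G₂).map fun x => x = D.e g r)
    id fun g => prob_bind_eq_const _ _ _ fun r => by rw [prob_map]; exact prob_uniform_eq _
  rw [prob_eq_map, PMF.map_id] at this
  rw [this, ← Nat.card_eq_fintype_card, hD.card_right]
  simp

theorem exists_inverter [IsCyclic G₁] [IsCyclic G₂] (hD : D.IsCryptographicPairing) (q : ℕ)
    (α : List Bool) (A B : Machine) : ∃ C : Inverter,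
      codeTime D.cost C.code ≤
        2 * (A.time D.cost + B.time D.cost + D.opTime * q) + 2 * (4 * D.opTime) ∧
      owfScheme.attackProb D q α A B ^ 2 / 9 ≤ C.successProb D := by
  by_cases h : owfScheme.attackProb D q α A B ^ 2 / 9 ≤ 1 / p
  · refine ⟨guess, ?_, h.trans_eq (successProb_guess hD).symm⟩
    have : codeTime D.cost guess.code ≤ D.opTime := by
      simp [guess, codeTime, Instr.time, PairingData.opTime]
      omega
    omega
  · refine ⟨_, codeTime_attackInverter q A B D, ?_⟩
    have h2 := sq_attack_le hD q α A B
    have hp : (2 : ℝ) ≤ p := mod_cast (Fact.out : p.Prime).two_le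
    -- By $p\ge2$ the total loss is at most $5/p<5\epsilon^2/9$, which leaves more than
    -- $\epsilon^2/9$.
    have h3 : 2 / ((p : ℝ) - 1) ≤ 4 * (1 / p) := by
      rw [mul_one_div, div_le_div_iff₀ (by linarith) (by linarith)]
      linarith
    linarith [sq_nonneg (owfScheme.attackProb D q α A B)]

/-- One-wayness applied to the inverter gives $\epsilon_0^2/9<\epsilon'$ for the success probability
$\epsilon_0$ of the attack, that is $\epsilon_0<3\sqrt{\epsilon'}$. -/
theorem owfScheme_isSecure [IsCyclic G₁] [IsCyclic G₂] (hD : D.IsCryptographicPairing)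
    {t' ε' t ε : ℝ} {q : ℕ} (hone : D.IsOneWay t' ε') (hε : 3 * √ε' ≤ ε)
    (ht : t ≤ t' / 2 - (4 * D.opTime : ℕ) - D.opTime * q) : owfScheme.IsSecure D t q ε := by
  intro α B A hAB
  obtain ⟨C, hC, hs⟩ := exists_inverter hD q α A B
  have hC' : (codeTime D.cost C.code : ℝ) ≤
      2 * ((A.time D.cost + B.time D.cost : ℕ) + D.opTime * q) + 2 * (4 * D.opTime : ℕ) := by
    exact_mod_cast hC
  have h := hone C (by linarith)
  refine lt_of_lt_of_le ?_ hε
  have : owfScheme.attackProb D q α A B / 3 < √ε' := by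
    refine Real.lt_sqrt_of_sq_lt ?_
    rw [div_pow]
    norm_num
    linarith
  linarith

end Forking

end PairingId

end

/-! ### The theorem. -/

open PairingId
theorem corollaryc :
    ∃ K : ℕ, ∀ (p : ℕ) [Fact p.Prime] (G₁ G₂ : Type*) [CommGroup G₁] [Fintype G₁] [IsCyclic G₁]
      [CommGroup G₂] [Fintype G₂] [IsCyclic G₂] (D : PairingData p G₁ G₂),
      D.IsCryptographicPairing →
      ∃ c₀ c_s c_h : ℕ,
        (c₀ ≤ K * D.opTime ∧ c_s ≤ K * D.opTime ∧ c_h ≤ K * D.opTime) ∧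
        -- the protocol is an identification scheme
        (∀ (t' ε' t ε : ℝ) (q : ℕ), D.IsOneWay t' ε' → max (3 * √ε') (2 / p) ≤ ε →
          t ≤ t' / 2 - c₀ - c_s * q →
          owfScheme.IsSecure D t q ε ∧
            (c_h ≤ t → owfScheme.IsIdentificationScheme D t q ε)) ∧
        -- the cost and the success probability of the reduction
        (∀ (q : ℕ) (α : List Bool) (A B : Machine), ∃ C : Inverter,
          codeTime D.cost C.code ≤ 2 * (A.time D.cost + B.time D.cost + c_s * q) + 2 * c₀ ∧
          owfScheme.attackProb D q α A B ^ 2 / 9 ≤ C.successProb D) := by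
  -- Here $c_0=4\tau$ covers half the overhead of the reduction, $c_s=\tau$ one run of the prover,
  -- and $c_h=2\tau$ the verifier, in which `pow2` and `mul2` occur twice.
  refine ⟨4, fun p _ G₁ G₂ _ _ _ _ _ _ D hD => ⟨4 * D.opTime, D.opTime, 2 * D.opTime,
    ⟨le_rfl, by omega, by omega⟩, fun t' ε' t ε q hone hε ht => ?_, exists_inverter hD⟩⟩
  have hs := owfScheme_isSecure hD hone ((le_max_left _ _).trans hε) ht
  refine ⟨hs, fun hc => ⟨⟨Polynomial.C (codeTime D.cost (owfScheme.gen []).code), fun α => ?_⟩,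
    le_trans ?_ hc, le_trans ?_ hc, owfScheme_isViable hD, hs⟩⟩
  · rw [Polynomial.eval_C, owfScheme]
  · exact Nat.cast_le.2 ((prover_time_le D).trans (by omega))
  · exact Nat.cast_le.2 (verifier_time_le D)
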